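/- Let $\alpha,\beta\in(1,2)$, $L_1<R_1$, $L_2<R_2$, $d>0$, $e>0$. For $\gamma\in(1,2)$ put $$w_\gamma(\theta)=-\tfrac{2-\gamma(1-e^{-\mathbf i\theta})}{2}\,(1-e^{\mathbf i\theta})^{\gamma},\qquad q_\gamma(\theta)=w_\gamma(\theta)+\overline{w_\gamma(\theta)},$$ let $g_k^{(\gamma)}=(-1)^k\binom{\gamma}{k}$, $w_0^{(\gamma)}=\frac{\gamma}{2}g_0^{(\gamma)}$, $w_k^{(\gamma)}=\frac{\gamma}{2}g_k^{(\gamma)}+\frac{2-\gamma}{2}g_{k-1}^{(\gamma)}$ for $k\ge1$, and let $S_{\gamma,n}$ be the $n\times n$ matrix whose $(k,j)$ entry is $-w^{(\gamma)}_{k-j+1}$ if $k-j\ge-1$ and $0$ otherwise. For a function $f$ on $[-\pi,\pi]$ let $T_n(f)=[a_{k-j}]_{k,j=1}^n$ with $a_k=\frac1{2\pi}\int_{-\pi}^{\pi}f(\theta)e^{-\mathbf ik\theta}\,d\theta$. For $n_1,n_2\ge 1$, $N=n_1n_2$ and a time step $h_t>0$ put $h_x=\frac{R_1-L_1}{n_1+1}$,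 $h_y=\frac{R_2-L_2}{n_2+1}$, $r=\frac{h_t}{2h_x^\alpha}$, $s=\frac{h_t}{2h_y^\beta}$. The Crank--Nicolson scheme with second-order shifted Grünwald discretization in space for the two-dimensional fractional diffusion equation of orders $\alpha$ (in $x$) and $\beta$ (in $y$) on $(L_1,R_1)\times(L_2,R_2)$ has at time $t$ the coefficient matrix $$\mathcal M_N=\tfrac1r\mathbb I_N+D_+(\mathbb I_{n_2}\otimes S_{\alpha,n_1})+D_-(\mathbb I_{n_2}\otimes S_{\alpha,n_1}^{\mathrm T})+\tfrac sr\left(E_+(S_{\beta,n_2}\otimes\mathbb I_{n_1})+E_-(S_{\beta,n_2}^{\mathrm T}\otimes\mathbb I_{n_1})\right),$$ where $D_\pm,E_\pm$ are the diagonal matrices of the samples at time $t$ of the diffusion coefficients $d_\pm,e_\pm$ at the interior grid points $(L_1+ih_x,\,L_2+jh_y)$, $1\le i\le n_1$, $1\le j\le n_2$, ordered with $i$ running fastest. Let $\theta_{j,n}=\frac{j\pi}{n+1}$, let $\mathbb S_n$ be the $n\times n$ sine transform matrix with entries $\sqrt{\tfrac{2}{n+1}}\sin(i\theta_{j,n})$,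 and let $$\mathcal P_N=(\mathbb S_{n_2}\otimes\mathbb S_{n_1})\,\hat F_N\,(\mathbb S_{n_2}\otimes\mathbb S_{n_1}),$$ where $\hat F_N$ is the diagonal matrix of the samples $\hat{\mathcal F}(\theta_{i,n_1},\theta_{j,n_2})$, in the same order, of $\hat{\mathcal F}(\theta_1,\theta_2)=\frac1r+d\,q_\alpha(\theta_1)+\frac sr\,e\,q_\beta(\theta_2)$. **Theorem.** Assume $d_\pm=d$ and $e_\pm=e$ are constant. Then, for all $n_1,n_2\ge1$ and $h_t>0$, the coefficient matrix $\mathcal M_N$ equals $$A_N=\tfrac1r\mathbb I_N+\mathbb I_{n_2}\otimes\hat A^\alpha_{n_1}+A^\beta_{n_2}\otimes\mathbb I_{n_1}=\mathbb I_{n_2}\otimes A^\alpha_{n_1}+A^\beta_{n_2}\otimes\mathbb I_{n_1},$$ where $$\hat A^\alpha_{n_1}=T_{n_1}\big(d\,(w_\alpha(\theta)+w_\alpha(-\theta))\big)=T_{n_1}(d\,q_\alpha),\qquad A^\alpha_{n_1}=\tfrac1r\mathbb I_{n_1}+\hat A^\alpha_{n_1}=T_{n_1}\big(\tfrac1r+d\,q_\alpha\big),$$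 $$A^\beta_{n_2}=T_{n_2}\big(e\tfrac sr(w_\beta(\theta)+w_\beta(-\theta))\big)=T_{n_2}\big(e\tfrac sr\,q_\beta\big).$$ The matrices $A^\alpha_{n_1}$, $A^\beta_{n_2}$, $A_N$ and $\mathcal P_N$ are real symmetric positive definite. Moreover there are constants $c,C>0$, independent of $n_1$, $n_2$ (hence of $N$) and of $h_t$, such that for all $n_1,n_2\ge1$ and $h_t>0$ all the eigenvalues of $\mathcal P_N^{-1}A_N$ are real and lie in $[c,C]$. -/

import Mathlib

open scoped Matrix Kronecker ComplexOrder ComplexConjugate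

noncomputable section

namespace FracDiff

/-- The fractional binomial coefficients `g_k = (-1)^k α(α-1)⋯(α-k+1) / k!`. -/
def gCoeff (α : ℝ) (k : ℕ) : ℝ :=
  (-1) ^ k / (k.factorial : ℝ) * ∏ i ∈ Finset.range k, (α - (i : ℝ))

/-- The weights of the second-order shifted Grünwald scheme:
`w_0 = (α/2) g_0` and `w_k = (α/2) g_k + ((2-α)/2) g_{k-1}` for `k ≥ 1`. -/
def wCoeff (α : ℝ) : ℕ → ℝ
  | 0 => α / 2 * gCoeff α 0
  | k + 1 => α / 2 * gCoeff α (k + 1) + (2 - α) / 2 * gCoeff α k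

/-- The lower Hessenberg Toeplitz matrix `S_{α,n}` of the second-order scheme: its entry in
row `k` and column `j` is `-w_{k-j+1}` when `k - j ≥ -1`, and `0` otherwise. -/
def secondOrderMatrix (α : ℝ) (n : ℕ) : Matrix (Fin n) (Fin n) ℝ :=
  Matrix.of fun k j =>
    if (j : ℕ) ≤ (k : ℕ) + 1 then -wCoeff α ((k : ℕ) + 1 - (j : ℕ)) else 0

/-- The step size `(R - L) / (n + 1)` of the uniform grid with `n` interior points. -/
def meshSize (L R : ℝ) (n : ℕ) : ℝ := (R - L) / ((n : ℝ) + 1)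

/-- The interior grid point `L + i h`, for `i = 1, …, n`; the index `i` is `k + 1`. -/
def gridPoint (L R : ℝ) (n : ℕ) (k : Fin n) : ℝ := L + (((k : ℕ) : ℝ) + 1) * meshSize L R n

/-- The ratio `h_t / (2 h ^ γ)`, where `h` is the space step. It is called `r` for the
`x`-direction (with `γ = α`) and `s` for the `y`-direction (with `γ = β`). -/
def stepRatio (γ L R ht : ℝ) (n : ℕ) : ℝ := ht / (2 * meshSize L R n ^ γ)

/-- The diagonal matrix of the samples of `c` on the grid at time `t`. The pair `(j, i)` stands for
the grid point `(x_i, y_j)`; in the lexicographic order on pairs the index `i` runs fastest. -/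
def coeffDiag (L₁ R₁ L₂ R₂ : ℝ) (n₁ n₂ : ℕ) (c : ℝ → ℝ → ℝ → ℝ) (t : ℝ) :
    Matrix (Fin n₂ × Fin n₁) (Fin n₂ × Fin n₁) ℝ :=
  Matrix.diagonal fun p => c (gridPoint L₁ R₁ n₁ p.2) (gridPoint L₂ R₂ n₂ p.1) t

/-- The coefficient matrix at time `t` of the Crank-Nicolson scheme, with second-order spatial
discretization and time step `ht`, for the two-dimensional fractional diffusion equation on
`(L₁, R₁) × (L₂, R₂)` with fractional orders `α, β` and diffusion coefficients `d₊, d₋, e₊, e₋`: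
`(1/r) I + D₊ (I ⊗ S_α) + D₋ (I ⊗ S_αᵀ) + (s/r) (E₊ (S_β ⊗ I) + E₋ (S_βᵀ ⊗ I))`. -/
def coefficientMatrix (α β L₁ R₁ L₂ R₂ ht : ℝ) (n₁ n₂ : ℕ)
    (dPlus dMinus ePlus eMinus : ℝ → ℝ → ℝ → ℝ) (t : ℝ) :
    Matrix (Fin n₂ × Fin n₁) (Fin n₂ × Fin n₁) ℝ :=
  (1 / stepRatio α L₁ R₁ ht n₁) • (1 : Matrix (Fin n₂ × Fin n₁) (Fin n₂ × Fin n₁) ℝ)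
    + (coeffDiag L₁ R₁ L₂ R₂ n₁ n₂ dPlus t *
          ((1 : Matrix (Fin n₂) (Fin n₂) ℝ) ⊗ₖ secondOrderMatrix α n₁)
      + coeffDiag L₁ R₁ L₂ R₂ n₁ n₂ dMinus t *
          ((1 : Matrix (Fin n₂) (Fin n₂) ℝ) ⊗ₖ (secondOrderMatrix α n₁)ᵀ))
    + (stepRatio β L₂ R₂ ht n₂ / stepRatio α L₁ R₁ ht n₁) •
      (coeffDiag L₁ R₁ L₂ R₂ n₁ n₂ ePlus t *
          (secondOrderMatrix β n₂ ⊗ₖ (1 : Matrix (Fin n₁) (Fin n₁) ℝ))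
      + coeffDiag L₁ R₁ L₂ R₂ n₁ n₂ eMinus t *
          ((secondOrderMatrix β n₂)ᵀ ⊗ₖ (1 : Matrix (Fin n₁) (Fin n₁) ℝ)))

/-- The Fourier coefficient `a_k = (1/2π) ∫_{-π}^{π} f(θ) e^{-ikθ} dθ`. -/
def fourierCoefficient (f : ℝ → ℂ) (k : ℤ) : ℂ :=
  1 / (2 * (Real.pi : ℂ)) *
    ∫ θ in (-Real.pi)..Real.pi, f θ * Complex.exp (-(Complex.I * (k : ℂ) * (θ : ℂ)))

/-- The Toeplitz matrix `T_n(f) = [a_{k-j}]` generated by `f`. -/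
def toeplitz (n : ℕ) (f : ℝ → ℂ) : Matrix (Fin n) (Fin n) ℂ :=
  Matrix.of fun k j => fourierCoefficient f (((k : ℕ) : ℤ) - ((j : ℕ) : ℤ))

/-- The symbol `w_α(θ) = -((2 - α (1 - e^{-iθ})) / 2) (1 - e^{iθ})^α`, with the principal branch
of the power. -/
def wSymbol (α θ : ℝ) : ℂ :=
  -((2 - (α : ℂ) * (1 - Complex.exp (-(Complex.I * (θ : ℂ))))) / 2) *
    (1 - Complex.exp (Complex.I * (θ : ℂ))) ^ (α : ℂ)

/-- The symbol `q_α(θ) = w_α(θ) + conj (w_α(θ))`. -/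
def qSymbol (α θ : ℝ) : ℂ := wSymbol α θ + conj (wSymbol α θ)

/-- The sampling angle `θ_j = j π / (n + 1)`, for `j = 1, …, n`; the index `j` is `k + 1`. -/
def sineAngle (n : ℕ) (k : Fin n) : ℝ := (((k : ℕ) : ℝ) + 1) * Real.pi / ((n : ℝ) + 1)

/-- The discrete sine transform matrix, with entries `√(2/(n+1)) sin(i θ_j)`. -/
def sineMatrix (n : ℕ) : Matrix (Fin n) (Fin n) ℂ :=
  Matrix.of fun i j =>
    ((Real.sqrt (2 / ((n : ℝ) + 1)) * Real.sin ((((i : ℕ) : ℝ) + 1) * sineAngle n j) : ℝ) : ℂ)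

/-- The two-dimensional `τ` matrix
`(S_{n₂} ⊗ S_{n₁}) diag(F(θ_{i,n₁}, θ_{j,n₂})) (S_{n₂} ⊗ S_{n₁})`. -/
def tauMatrix (n₁ n₂ : ℕ) (F : ℝ → ℝ → ℂ) :
    Matrix (Fin n₂ × Fin n₁) (Fin n₂ × Fin n₁) ℂ :=
  (sineMatrix n₂ ⊗ₖ sineMatrix n₁) *
    Matrix.diagonal (fun p : Fin n₂ × Fin n₁ => F (sineAngle n₁ p.2) (sineAngle n₂ p.1)) *
    (sineMatrix n₂ ⊗ₖ sineMatrix n₁)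

/-- Symmetric positive definite. A complex matrix that is both symmetric and Hermitian has
real entries, so this is the usual notion of a real symmetric positive definite matrix. -/
def IsSPD {m : Type*} [Fintype m] (A : Matrix m m ℂ) : Prop := A.IsSymm ∧ A.PosDef

end FracDiff

end

noncomputable section

namespace FracDiff

/-! Everything reduces to the one-variable Loewner bounds `τ/2 ≤ T ≤ τ`, where `T` is the Toeplitz
matrix of `q_γ` and `τ` is the sine-transform matrix sampling `q_γ`. Kronecker products with the
identity, nonnegative combinations and the common term `1/r` preserve these bounds, so `P/2 ≤ A_N ≤
P`, and Rayleigh quotients put the spectrum in `[1/2, 1]`.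

Let `a_m` be the Fourier coefficients of `q_γ`. They are even and summable, have sum `q_γ(0) = 0`,
and are negative for `m ≠ 0`. Moreover `-a_{k+2}` is the `k`-th moment of a positive density on
`(0,1)` (`exists_moment_functional`), because the Grünwald coefficients are Beta integrals.

Upper bound: aliasing writes the entries of `τ` as `a` periodized with period `2(n+1)`, at `j-k`
minus at `j+k+2` (`tauReal_apply`). Removing `a_{j-k}` leaves a Hankel moment matrix plus a series
of Gram matrices for the moment functional (`hasSum_tauReal_sub_toeplitzReal`). Hence `τ - T` is
positive semidefinite, and also entrywise nonnegative.

Lower bound: `2T - τ = T - (τ - T)` then has nonpositive off-diagonal entries, and `∑ a_m = 0` makes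
its row sums nonnegative, so it is diagonally dominant (`posSemidef_two_toeplitzReal_sub_tauReal`).
-/

/-! ### Grünwald coefficients and the binomial series on the closed disc. -/

lemma gCoeff_zero (γ : ℝ) : gCoeff γ 0 = 1 := by simp [gCoeff]

lemma gCoeff_succ (γ : ℝ) (k : ℕ) :
    gCoeff γ (k + 1) = gCoeff γ k * (((k : ℝ) - γ) / ((k : ℝ) + 1)) := by
  have h : (k.factorial : ℝ) ≠ 0 := by exact_mod_cast k.factorial_ne_zero
  have h' : (k : ℝ) + 1 ≠ 0 := by positivity
  simp only [gCoeff, Finset.prod_range_succ, Nat.factorial_succ, Nat.cast_mul, Nat.cast_add,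
    Nat.cast_one]
  field_simp
  ring

lemma gCoeff_one (γ : ℝ) : gCoeff γ 1 = -γ := by
  simpa [gCoeff_zero] using gCoeff_succ γ 0

lemma gCoeff_two (γ : ℝ) : gCoeff γ 2 = γ * (γ - 1) / 2 := by
  have := gCoeff_succ γ 1
  rw [gCoeff_one] at this
  norm_num at this
  linarith

lemma gCoeff_pos {γ : ℝ} (hγ : γ ∈ Set.Ioo (1 : ℝ) 2) (k : ℕ) : 0 < gCoeff γ (k + 2) := by
  obtain ⟨h1, h2⟩ := hγ
  induction k with
  | zero => rw [gCoeff_two]; nlinarith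
  | succ k ih =>
    rw [show k + 1 + 2 = (k + 2) + 1 by ring, gCoeff_succ]
    refine mul_pos ih (div_pos ?_ (by positivity))
    push_cast
    have : (0 : ℝ) ≤ k := k.cast_nonneg
    linarith

/-- Partial sums of the Grünwald coefficients. -/
lemma sum_gCoeff (γ : ℝ) (n : ℕ) :
    ∑ k ∈ Finset.range (n + 1), gCoeff γ k = gCoeff (γ - 1) n := by
  -- Coefficient form of `d/dz (1-z)^γ = -γ (1-z)^(γ-1)`.
  have key : ∀ n : ℕ, gCoeff γ (n + 1) = gCoeff (γ - 1) n * (-γ / ((n : ℝ) + 1)) := by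
    intro n
    induction n with
    | zero => simp [gCoeff_one, gCoeff_zero]
    | succ n ih =>
      rw [gCoeff_succ γ (n + 1), ih, gCoeff_succ (γ - 1) n]
      have h' : (n : ℝ) + 1 ≠ 0 := by positivity
      have h'' : (n : ℝ) + 1 + 1 ≠ 0 := by positivity
      push_cast
      field_simp
      ring
  induction n with
  | zero => simp [gCoeff_zero]
  | succ n ih =>
    rw [Finset.sum_range_succ, ih, key, gCoeff_succ]
    have h' : (n : ℝ) + 1 ≠ 0 := by positivity
    field_simp
    ring

lemma gCoeff_sub_one_neg {γ : ℝ} (hγ : γ ∈ Set.Ioo (1 : ℝ) 2) (n : ℕ) :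
    gCoeff (γ - 1) (n + 1) < 0 := by
  obtain ⟨h1, h2⟩ := hγ
  induction n with
  | zero => rw [gCoeff_one]; linarith
  | succ n ih =>
    rw [gCoeff_succ]
    refine mul_neg_of_neg_of_pos ih (div_pos ?_ (by positivity))
    push_cast
    have : (0 : ℝ) ≤ n := n.cast_nonneg
    linarith

/-- From index 2 on the terms are positive. The full partial sums are coefficients for `γ - 1`,
hence negative, and `g_0 + g_1 = 1 - γ`, so the tail is bounded by `γ - 1`. -/
lemma summable_gCoeff {γ : ℝ} (hγ : γ ∈ Set.Ioo (1 : ℝ) 2) : Summable (gCoeff γ) := by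
  rw [← summable_nat_add_iff 2]
  refine summable_of_sum_range_le (c := γ - 1) (fun k => (gCoeff_pos hγ k).le) fun n => ?_
  have h := sum_gCoeff γ (n + 1)
  rw [Finset.sum_range_succ', Finset.sum_range_succ'] at h
  have h' := gCoeff_sub_one_neg hγ n
  simp only [gCoeff_zero, zero_add, gCoeff_one] at h
  linarith

lemma gCoeff_eq_choose (γ : ℝ) (k : ℕ) : gCoeff γ k = (-1) ^ k * Ring.choose γ k := by
  rw [Ring.choose_eq_smul, ← Polynomial.aeval_eq_smeval, ← Polynomial.eval_map_algebraMap,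
    descPochhammer_map, descPochhammer_eval_eq_prod_range, gCoeff, smul_eq_mul]
  ring

lemma hasSum_gCoeff_of_norm_lt_one (γ : ℝ) {z : ℂ} (hz : ‖z‖ < 1) :
    HasSum (fun k : ℕ => (gCoeff γ k : ℂ) * z ^ k) ((1 - z) ^ (γ : ℂ)) := by
  have h := (Complex.one_add_cpow_hasFPowerSeriesOnBall_zero (a := (γ : ℂ))).hasSum
    (y := -z) (by simpa [enorm_eq_nnnorm, ← NNReal.coe_lt_coe] using hz)
  rw [zero_add, ← sub_eq_add_neg] at h
  have hf : (fun k : ℕ => (binomialSeries ℂ (γ : ℂ) k) fun _ => -z) =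
      fun k : ℕ => (gCoeff γ k : ℂ) * z ^ k := by
    funext k
    rw [binomialSeries_apply, gCoeff_eq_choose, List.ofFn_const, List.prod_replicate, smul_eq_mul,
      neg_pow z]
    push_cast [Complex.ofReal_choose]
    ring
  rwa [hf] at h

/-- On the closed disc `1 - z` meets the branch cut only at `z = 1`, where continuity comes from `γ
> 0`. -/
lemma continuousOn_one_sub_cpow {γ : ℝ} (hγ : 0 < γ) :
    ContinuousOn (fun z : ℂ => (1 - z) ^ (γ : ℂ)) (Metric.closedBall 0 1) := by
  intro z hz
  refine ContinuousAt.continuousWithinAt ?_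
  have hre : z.re ≤ 1 := (Complex.re_le_norm z).trans (by simpa using hz)
  by_cases h1 : z = 1
  · subst h1
    have := Complex.continuousAt_cpow_const_of_re_pos (z := 1 - 1) (w := (γ : ℂ)) (by simp) (by simpa)
    exact this.comp (f := fun z : ℂ => 1 - z) (by fun_prop)
  · refine ContinuousAt.cpow (by fun_prop) (by fun_prop) ?_
    rw [Complex.mem_slitPlane_iff]
    by_contra! h
    simp only [Complex.sub_re, Complex.one_re, Complex.sub_im, Complex.one_im] at h
    apply h1
    refine Complex.ext ?_ ?_
    · rw [Complex.one_re]; linarith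
    · rw [Complex.one_im]; linarith

/-- The symbol lives on `|z| = 1`, outside the open disc of the binomial series. Both sides are
continuous on the closed disc, so the identity extends by density. -/
lemma hasSum_gCoeff {γ : ℝ} (hγ : γ ∈ Set.Ioo (1 : ℝ) 2) {z : ℂ} (hz : ‖z‖ ≤ 1) :
    HasSum (fun k : ℕ => (gCoeff γ k : ℂ) * z ^ k) ((1 - z) ^ (γ : ℂ)) := by
  have hs : Summable fun k : ℕ => ‖(gCoeff γ k : ℂ)‖ := by
    simpa using (summable_gCoeff hγ).abs
  have hb : ∀ (k : ℕ) (z : ℂ), z ∈ Metric.closedBall (0 : ℂ) 1 →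
      ‖(gCoeff γ k : ℂ) * z ^ k‖ ≤ ‖(gCoeff γ k : ℂ)‖ := by
    intro k z hz
    rw [norm_mul, norm_pow]
    exact mul_le_of_le_one_right (norm_nonneg _)
      (pow_le_one₀ (norm_nonneg _) (by simpa using hz))
  have hc : ContinuousOn (fun z : ℂ => ∑' k : ℕ, (gCoeff γ k : ℂ) * z ^ k)
      (Metric.closedBall 0 1) :=
    continuousOn_tsum (fun k => by fun_prop) hs hb
  have heq : Set.EqOn (fun z : ℂ => ∑' k : ℕ, (gCoeff γ k : ℂ) * z ^ k)
      (fun z : ℂ => (1 - z) ^ (γ : ℂ)) (closure (Metric.ball 0 1)) := by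
    refine Set.EqOn.of_subset_closure (t := closure (Metric.ball 0 1)) (s := Metric.ball 0 1) ?_ ?_ ?_ subset_closure subset_rfl
    · intro z hz
      exact (hasSum_gCoeff_of_norm_lt_one γ (by simpa using hz)).tsum_eq
    · rwa [closure_ball _ one_ne_zero]
    · rw [closure_ball _ one_ne_zero]
      exact continuousOn_one_sub_cpow (by linarith [hγ.1])
  rw [closure_ball _ one_ne_zero] at heq
  have hz' : z ∈ Metric.closedBall (0 : ℂ) 1 := by simpa using hz
  have hz'' := heq hz'
  simp only at hz''
  rw [← hz'']
  exact (Summable.of_norm_bounded hs fun k => hb k z hz').hasSum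

/-! ### Grünwald coefficients as Beta integrals. -/

lemma beta_add_one_left {u v : ℝ} (hu : 0 < u) (hv : 0 < v) :
    ProbabilityTheory.beta (u + 1) v = u / (u + v) * ProbabilityTheory.beta u v := by
  have h : Real.Gamma (u + v) ≠ 0 := (Real.Gamma_pos_of_pos (by linarith)).ne'
  have h' : u + v ≠ 0 := by linarith
  rw [ProbabilityTheory.beta, ProbabilityTheory.beta, add_right_comm, Real.Gamma_add_one hu.ne',
    Real.Gamma_add_one h']
  field_simp

lemma beta_eq_integral {u v : ℝ} (hu : 0 < u) (hv : 0 < v) :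
    ProbabilityTheory.beta u v = ∫ x in (0 : ℝ)..1, x ^ (u - 1) * (1 - x) ^ (v - 1) := by
  rw [ProbabilityTheory.beta_eq_betaIntegralReal u v hu hv, Complex.betaIntegral]
  have : ∫ x : ℝ in 0..1, (x : ℂ) ^ ((u : ℂ) - 1) * (1 - (x : ℂ)) ^ ((v : ℂ) - 1)
      = ∫ x : ℝ in 0..1, ((x ^ (u - 1) * (1 - x) ^ (v - 1) : ℝ) : ℂ) := by
    refine intervalIntegral.integral_congr fun x hx => ?_
    rw [Set.uIcc_of_le zero_le_one] at hx
    rw [Complex.ofReal_mul, Complex.ofReal_cpow hx.1, Complex.ofReal_cpow (by linarith [hx.2])]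
    push_cast
    rfl
  rw [this, intervalIntegral.integral_ofReal, Complex.ofReal_re]

/-- Both sides satisfy the recurrence with ratio `(k+2-γ)/(k+3)`. -/
lemma gCoeff_eq_beta {γ : ℝ} (hγ : γ ∈ Set.Ioo (1 : ℝ) 2) (k : ℕ) :
    gCoeff γ (k + 2) = gCoeff γ 2 / ProbabilityTheory.beta (2 - γ) (γ + 1) *
      ProbabilityTheory.beta ((k : ℝ) + (2 - γ)) (γ + 1) := by
  obtain ⟨h1, h2⟩ := hγ
  have h0 := (ProbabilityTheory.beta_pos (α := 2 - γ) (β := γ + 1) (by linarith) (by linarith)).ne'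
  induction k with
  | zero => simp [h0]
  | succ k ih =>
    have hk : (0 : ℝ) ≤ k := k.cast_nonneg
    rw [show k + 1 + 2 = (k + 2) + 1 by ring, gCoeff_succ, ih,
      show ((k + 1 : ℕ) : ℝ) + (2 - γ) = (k + (2 - γ)) + 1 by push_cast; ring,
      beta_add_one_left (by linarith) (by linarith)]
    push_cast
    rw [show (k : ℝ) + (2 - γ) + (γ + 1) = k + 2 + 1 by ring,
      show (k : ℝ) + (2 - γ) = k + 2 - γ by ring]
    ring

/-! ### Fourier series of the symbols and signs of their coefficients. -/

/-- The Fourier coefficients of `wSymbol`. -/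
def shiftCoeff (γ : ℝ) (m : ℤ) : ℝ := if -1 ≤ m then -wCoeff γ (m + 1).toNat else 0

/-- The Fourier coefficients of `qSymbol`. -/
def symbolCoeff (γ : ℝ) (m : ℤ) : ℝ := shiftCoeff γ m + shiftCoeff γ (-m)

lemma symbolCoeff_neg (γ : ℝ) (m : ℤ) : symbolCoeff γ (-m) = symbolCoeff γ m := by
  rw [symbolCoeff, symbolCoeff, neg_neg, add_comm]

lemma shiftCoeff_natCast_sub_one (γ : ℝ) (k : ℕ) : shiftCoeff γ ((k : ℤ) - 1) = -wCoeff γ k := by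
  rw [shiftCoeff, if_pos (by omega), sub_add_cancel, Int.toNat_natCast]

lemma shiftCoeff_of_lt (γ : ℝ) {m : ℤ} (hm : m < -1) : shiftCoeff γ m = 0 := by
  rw [shiftCoeff, if_neg (by omega)]

lemma shiftCoeff_eq_zero_of_notMem_range (γ : ℝ) (m : ℤ)
    (hm : m ∉ Set.range fun k : ℕ => (k : ℤ) - 1) : shiftCoeff γ m = 0 := by
  refine shiftCoeff_of_lt γ ?_
  by_contra h
  exact hm ⟨(m + 1).toNat, by simp only; omega⟩

lemma injective_natCast_sub_one : Function.Injective fun k : ℕ => (k : ℤ) - 1 := fun a b h => by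
  simp only at h; omega

lemma hasSum_wCoeff {γ : ℝ} (hγ : γ ∈ Set.Ioo (1 : ℝ) 2) {z : ℂ} (hz : ‖z‖ ≤ 1) :
    HasSum (fun k : ℕ => (wCoeff γ k : ℂ) * z ^ k)
      (((γ : ℂ) / 2 + (2 - (γ : ℂ)) / 2 * z) * (1 - z) ^ (γ : ℂ)) := by
  have h := hasSum_gCoeff hγ hz
  have h1 := h.mul_left ((2 - (γ : ℂ)) / 2 * z)
  have h2 := (hasSum_nat_add_iff' 1).2 (h.mul_left ((γ : ℂ) / 2))
  rw [← hasSum_nat_add_iff' 1]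
  convert! h1.add h2 using 1
  · funext k
    simp only [wCoeff]
    push_cast
    ring
  · simp only [Finset.sum_range_one, wCoeff, gCoeff_zero]
    push_cast
    ring

lemma summable_wCoeff {γ : ℝ} (hγ : γ ∈ Set.Ioo (1 : ℝ) 2) : Summable (wCoeff γ) := by
  have h := (hasSum_wCoeff hγ (z := 1) (by simp)).summable
  simp only [one_pow, mul_one] at h
  exact Complex.summable_ofReal.1 h

lemma summable_shiftCoeff {γ : ℝ} (hγ : γ ∈ Set.Ioo (1 : ℝ) 2) : Summable (shiftCoeff γ) := by
  rw [← injective_natCast_sub_one.summable_iff (shiftCoeff_eq_zero_of_notMem_range γ)]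
  exact (summable_wCoeff hγ).neg.congr fun k => (shiftCoeff_natCast_sub_one γ k).symm

lemma summable_symbolCoeff {γ : ℝ} (hγ : γ ∈ Set.Ioo (1 : ℝ) 2) : Summable (symbolCoeff γ) :=
  (summable_shiftCoeff hγ).add
    ((summable_shiftCoeff hγ).comp_injective neg_injective)

lemma hasSum_shiftCoeff {γ : ℝ} (hγ : γ ∈ Set.Ioo (1 : ℝ) 2) (θ : ℝ) :
    HasSum (fun m : ℤ => (shiftCoeff γ m : ℂ) * Complex.exp (Complex.I * m * θ))
      (wSymbol γ θ) := by
  rw [← injective_natCast_sub_one.hasSum_iff fun m hm => by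
    rw [shiftCoeff_eq_zero_of_notMem_range γ m hm, Complex.ofReal_zero, zero_mul]]
  have hz : ‖Complex.exp (Complex.I * θ)‖ ≤ 1 := by
    rw [mul_comm, Complex.norm_exp_ofReal_mul_I]
  have hinv : Complex.exp (-(Complex.I * θ)) * Complex.exp (Complex.I * θ) = 1 := by
    rw [← Complex.exp_add, neg_add_cancel, Complex.exp_zero]
  -- The symbol is `-e^{-iθ}` times the generating function of the weights at `z = e^{iθ}`; this
  -- factor is the one-step shift of the index.
  convert! (hasSum_wCoeff hγ hz).mul_left (-Complex.exp (-(Complex.I * θ))) using 1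
  · funext k
    simp only [Function.comp_apply]
    rw [shiftCoeff_natCast_sub_one, ← Complex.exp_nat_mul,
      show Complex.I * (((k : ℤ) - 1 : ℤ) : ℂ) * θ =
        -(Complex.I * θ) + (k : ℂ) * (Complex.I * θ) by push_cast; ring, Complex.exp_add]
    push_cast
    ring
  · rw [wSymbol]
    linear_combination (2 - (γ : ℂ)) / 2 * (1 - Complex.exp (Complex.I * θ)) ^ (γ : ℂ) * hinv

/-- The Fourier coefficients are real, so no discussion of the branch of the power is needed. -/
lemma wSymbol_neg {γ : ℝ} (hγ : γ ∈ Set.Ioo (1 : ℝ) 2) (θ : ℝ) :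
    wSymbol γ (-θ) = conj (wSymbol γ θ) := by
  refine (hasSum_shiftCoeff hγ (-θ)).unique ?_
  have h := Complex.hasSum_conj'.2 (hasSum_shiftCoeff hγ θ)
  convert! h using 2 with m
  rw [map_mul, Complex.conj_ofReal, ← Complex.exp_conj]
  simp

lemma qSymbol_eq {γ : ℝ} (hγ : γ ∈ Set.Ioo (1 : ℝ) 2) (θ : ℝ) :
    qSymbol γ θ = wSymbol γ θ + wSymbol γ (-θ) := by
  rw [qSymbol, wSymbol_neg hγ]

lemma hasSum_symbolCoeff {γ : ℝ} (hγ : γ ∈ Set.Ioo (1 : ℝ) 2) (θ : ℝ) :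
    HasSum (fun m : ℤ => (symbolCoeff γ m : ℂ) * Complex.exp (Complex.I * m * θ))
      (qSymbol γ θ) := by
  rw [qSymbol_eq hγ]
  have h := (Equiv.neg ℤ).hasSum_iff.2 (hasSum_shiftCoeff hγ (-θ))
  convert! (hasSum_shiftCoeff hγ θ).add h using 2 with m
  simp only [symbolCoeff, Function.comp_apply, Equiv.neg_apply]
  push_cast
  rw [add_mul]
  congr 3
  ring

lemma qSymbol_eq_re (γ θ : ℝ) : qSymbol γ θ = ((qSymbol γ θ).re : ℂ) := by
  rw [qSymbol, Complex.add_conj, Complex.ofReal_re]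

lemma hasSum_symbolCoeff_cos {γ : ℝ} (hγ : γ ∈ Set.Ioo (1 : ℝ) 2) (θ : ℝ) :
    HasSum (fun m : ℤ => symbolCoeff γ m * Real.cos (m * θ)) (qSymbol γ θ).re := by
  convert! Complex.hasSum_re (hasSum_symbolCoeff hγ θ) using 2 with m
  rw [Complex.re_ofReal_mul, show Complex.I * m * θ = ((m * θ : ℝ) : ℂ) * Complex.I by
    push_cast; ring, Complex.exp_ofReal_mul_I_re]

/-- Evaluation at `θ = 0`, where the factor `0^γ` vanishes. -/
lemma hasSum_symbolCoeff_zero {γ : ℝ} (hγ : γ ∈ Set.Ioo (1 : ℝ) 2) :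
    HasSum (symbolCoeff γ) 0 := by
  have h := hasSum_symbolCoeff_cos hγ 0
  have hγ0 : (γ : ℂ) ≠ 0 := by exact_mod_cast (by linarith [hγ.1] : γ ≠ 0)
  simpa [qSymbol, wSymbol, Complex.zero_cpow hγ0] using h

lemma wCoeff_pos {γ : ℝ} (hγ : γ ∈ Set.Ioo (1 : ℝ) 2) (k : ℕ) : 0 < wCoeff γ (k + 3) := by
  have h1 := gCoeff_pos hγ k
  have h2 := gCoeff_pos hγ (k + 1)
  have h3 : 0 < γ := by linarith [hγ.1]
  have h4 : 0 < 2 - γ := by linarith [hγ.2]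
  simp only [wCoeff]
  positivity

lemma symbolCoeff_add_two (γ : ℝ) (k : ℕ) : symbolCoeff γ ((k : ℤ) + 2) = -wCoeff γ (k + 3) := by
  rw [symbolCoeff, shiftCoeff_of_lt γ (by omega : -((k : ℤ) + 2) < -1), add_zero,
    ← shiftCoeff_natCast_sub_one]
  congr 1
  push_cast
  ring

/-- This coefficient is `-(w_2 + w_0)`. The weight `w_2` alone may be negative; adding `w_0` gives
the factor `γ² + γ - 2 = (γ-1)(γ+2) > 0`. -/
lemma symbolCoeff_one (γ : ℝ) : symbolCoeff γ 1 = -(γ * (γ ^ 2 + γ - 2) / 4) := by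
  have h1 := shiftCoeff_natCast_sub_one γ 2
  have h2 := shiftCoeff_natCast_sub_one γ 0
  norm_num at h1 h2
  rw [symbolCoeff, h1, h2]
  simp only [wCoeff, gCoeff_zero, gCoeff_one, gCoeff_two, one_add_one_eq_two]
  ring

lemma symbolCoeff_one_neg {γ : ℝ} (hγ : γ ∈ Set.Ioo (1 : ℝ) 2) : symbolCoeff γ 1 < 0 := by
  obtain ⟨h1, h2⟩ := hγ
  rw [symbolCoeff_one]
  have : 0 < γ * (γ ^ 2 + γ - 2) := mul_pos (by linarith) (by nlinarith)
  linarith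

lemma symbolCoeff_neg_of_ne_zero {γ : ℝ} (hγ : γ ∈ Set.Ioo (1 : ℝ) 2) {m : ℤ} (hm : m ≠ 0) :
    symbolCoeff γ m < 0 := by
  wlog h : 0 < m generalizing m
  · rw [← symbolCoeff_neg]
    exact this (by omega) (by omega)
  obtain rfl | h2 := eq_or_ne m 1
  · exact symbolCoeff_one_neg hγ
  · obtain ⟨k, rfl⟩ : ∃ k : ℕ, m = (k : ℤ) + 2 := ⟨(m - 2).toNat, by omega⟩
    rw [symbolCoeff_add_two]
    linarith [wCoeff_pos hγ k]

/-- Since the coefficients sum to zero, `q = ∑ a_m (cos mθ - 1)`, whose terms are nonnegative and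
whose term `m = 1` is positive. -/
lemma qSymbol_re_pos {γ : ℝ} (hγ : γ ∈ Set.Ioo (1 : ℝ) 2) {θ : ℝ} (hθ : θ ∈ Set.Ioo 0 Real.pi) :
    0 < (qSymbol γ θ).re := by
  have h := (hasSum_symbolCoeff_cos hγ θ).sub (hasSum_symbolCoeff_zero hγ)
  rw [sub_zero] at h
  have hcos : Real.cos θ < 1 := by
    rw [← Real.cos_zero]
    exact Real.cos_lt_cos_of_nonneg_of_le_pi le_rfl hθ.2.le hθ.1
  have hnn : ∀ m : ℤ, 0 ≤ symbolCoeff γ m * Real.cos (m * θ) - symbolCoeff γ m := by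
    intro m
    obtain rfl | hm := eq_or_ne m 0
    · simp
    · nlinarith [symbolCoeff_neg_of_ne_zero hγ hm, Real.cos_le_one (m * θ)]
  rw [← h.tsum_eq]
  refine h.summable.tsum_pos hnn 1 ?_
  rw [Int.cast_one, one_mul]
  nlinarith [symbolCoeff_one_neg hγ]

/-! ### Moment representation of the coefficients. -/

/-- The numbers `-symbolCoeff γ m`, `m ≥ 2`, are the moments of a positive functional on `(0,1)`. -/
lemma exists_moment_functional {γ : ℝ} (hγ : γ ∈ Set.Ioo (1 : ℝ) 2) :
    ∃ L : Polynomial ℝ →ₗ[ℝ] ℝ,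
      (∀ p : Polynomial ℝ, (∀ x ∈ Set.Ioo (0 : ℝ) 1, 0 ≤ p.eval x) → 0 ≤ L p) ∧
      ∀ k : ℕ, L (Polynomial.X ^ k) = -symbolCoeff γ ((k : ℤ) + 2) := by
  obtain ⟨h1, h2⟩ := id hγ
  set K : ℝ := gCoeff γ 2 / ProbabilityTheory.beta (2 - γ) (γ + 1) with hK
  have hK0 : 0 ≤ K := div_nonneg (gCoeff_pos hγ 0).le
    (ProbabilityTheory.beta_pos (by linarith) (by linarith)).le
  have hint : IntervalIntegrable (fun x : ℝ => x ^ (1 - γ) * (1 - x) ^ γ)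
      MeasureTheory.volume 0 1 := by
    refine (intervalIntegral.intervalIntegrable_rpow' (by linarith)).mul_continuousOn ?_
    exact ContinuousOn.rpow_const (by fun_prop) fun x _ => Or.inr (by linarith)
  have hint' : ∀ p : Polynomial ℝ, IntervalIntegrable
      (fun x : ℝ => x ^ (1 - γ) * (1 - x) ^ γ * p.eval x) MeasureTheory.volume 0 1 := fun p =>
    hint.mul_continuousOn p.continuous.continuousOn
  let L₀ : Polynomial ℝ →ₗ[ℝ] ℝ :=
    { toFun := fun p => K * ∫ x in (0 : ℝ)..1, x ^ (1 - γ) * (1 - x) ^ γ * p.eval x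
      map_add' := fun p q => by
        rw [← mul_add, ← intervalIntegral.integral_add (hint' p) (hint' q)]
        simp only [Polynomial.eval_add, mul_add]
      map_smul' := fun c p => by
        simp only [Polynomial.eval_smul, smul_eq_mul, RingHom.id_apply, mul_left_comm _ c,
          intervalIntegral.integral_const_mul] }
  have hL₀ : ∀ k : ℕ, L₀ (Polynomial.X ^ k) = gCoeff γ (k + 2) := by
    intro k
    have hk : (0 : ℝ) ≤ k := k.cast_nonneg
    rw [gCoeff_eq_beta hγ, ← hK, beta_eq_integral (by linarith) (by linarith)]
    change K * _ = _
    congr 1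
    refine intervalIntegral.integral_congr_ae ?_
    refine Filter.Eventually.of_forall fun x hx => ?_
    rw [Set.uIoc_of_le zero_le_one] at hx
    rw [Polynomial.eval_pow, Polynomial.eval_X, ← Real.rpow_natCast x k, add_sub_cancel_right,
      mul_right_comm, ← Real.rpow_add hx.1]
    congr 2
    ring
  have hL₀pos : ∀ p : Polynomial ℝ, (∀ x ∈ Set.Ioo (0 : ℝ) 1, 0 ≤ p.eval x) → 0 ≤ L₀ p := by
    intro p hp
    refine mul_nonneg hK0 ?_
    rw [intervalIntegral.integral_of_le zero_le_one, MeasureTheory.integral_Ioc_eq_integral_Ioo]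
    refine MeasureTheory.setIntegral_nonneg measurableSet_Ioo fun x hx => ?_
    have hx1 : 0 ≤ 1 - x := by linarith [hx.2]
    exact mul_nonneg (mul_nonneg (Real.rpow_nonneg hx.1.le _) (Real.rpow_nonneg hx1 _)) (hp x hx)
  -- Multiplying the density by `γx/2 + (2-γ)/2` turns the moments `g_{k+2}` into `(γ/2) g_{k+3} +
  -- ((2-γ)/2) g_{k+2} = w_{k+3}`.
  let q : Polynomial ℝ := Polynomial.C (γ / 2) * Polynomial.X + Polynomial.C ((2 - γ) / 2)
  refine ⟨L₀ ∘ₗ LinearMap.mulLeft ℝ q, fun p hp => hL₀pos _ fun x hx => ?_, fun k => ?_⟩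
  · rw [LinearMap.mulLeft_apply, Polynomial.eval_mul]
    refine mul_nonneg ?_ (hp x hx)
    simp only [q, Polynomial.eval_add, Polynomial.eval_mul, Polynomial.eval_C, Polynomial.eval_X]
    nlinarith [hx.1, mul_pos (by linarith : 0 < γ) hx.1]
  · rw [LinearMap.comp_apply, LinearMap.mulLeft_apply,
      show q * Polynomial.X ^ k = (γ / 2) • Polynomial.X ^ (k + 1) +
        ((2 - γ) / 2) • Polynomial.X ^ k by simp only [q, Polynomial.smul_eq_C_mul]; ring,
      map_add, map_smul, map_smul, hL₀, hL₀, symbolCoeff_add_two, neg_neg]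
    rfl

/-! ### Recovering Fourier coefficients from a series. -/

/-- Fourier coefficients of an absolutely convergent trigonometric series. -/
lemma fourierCoefficient_eq {a : ℤ → ℂ} {f : ℝ → ℂ} (ha : Summable fun m => ‖a m‖)
    (hf : ∀ θ : ℝ, HasSum (fun m : ℤ => a m * Complex.exp (Complex.I * m * θ)) (f θ)) (k : ℤ) :
    fourierCoefficient f k = a k := by
  have hpi : (Real.pi : ℂ) ≠ 0 := by exact_mod_cast Real.pi_ne_zero
  have hterm : ∀ m : ℤ, ∫ θ in (-Real.pi)..Real.pi,
      a m * Complex.exp (Complex.I * ((m - k : ℤ) : ℂ) * (θ : ℂ)) =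
        if m = k then 2 * Real.pi * a k else 0 := by
    intro m
    split_ifs with h
    · subst h
      rw [sub_self]
      simp only [Int.cast_zero, mul_zero, zero_mul, Complex.exp_zero, mul_one,
        intervalIntegral.integral_const, Complex.real_smul]
      push_cast
      ring
    · have hc : Complex.I * ((m - k : ℤ) : ℂ) ≠ 0 :=
        mul_ne_zero Complex.I_ne_zero (by exact_mod_cast sub_ne_zero.2 h)
      rw [intervalIntegral.integral_const_mul, integral_exp_mul_complex hc]
      have : Complex.exp (Complex.I * ((m - k : ℤ) : ℂ) * (Real.pi : ℝ)) =
          Complex.exp (Complex.I * ((m - k : ℤ) : ℂ) * ((-Real.pi : ℝ) : ℂ)) := by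
        rw [Complex.exp_eq_exp_iff_exists_int]
        exact ⟨m - k, by push_cast; ring⟩
      rw [this, sub_self, zero_div, mul_zero]
  have hs := intervalIntegral.hasSum_integral_of_dominated_convergence
    (μ := MeasureTheory.volume) (a := -Real.pi) (b := Real.pi)
    (F := fun (m : ℤ) (θ : ℝ) => a m * Complex.exp (Complex.I * ((m - k : ℤ) : ℂ) * (θ : ℂ)))
    (f := fun θ : ℝ => f θ * Complex.exp (-(Complex.I * (k : ℂ) * (θ : ℂ))))
    (fun (m : ℤ) (_ : ℝ) => ‖a m‖)
    (fun m => (by fun_prop : Continuous fun θ : ℝ =>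
      a m * Complex.exp (Complex.I * ((m - k : ℤ) : ℂ) * (θ : ℂ))).aestronglyMeasurable)
    (fun m => Filter.Eventually.of_forall fun θ _ => by
      rw [norm_mul, show Complex.I * ((m - k : ℤ) : ℂ) * (θ : ℂ) =
        (((m - k : ℤ) * θ : ℝ) : ℂ) * Complex.I by push_cast; ring, Complex.norm_exp_ofReal_mul_I,
        mul_one])
    (Filter.Eventually.of_forall fun _ _ => ha)
    (by simp)
    (Filter.Eventually.of_forall fun θ _ => by
      convert! (hf θ).mul_right (Complex.exp (-(Complex.I * (k : ℂ) * (θ : ℂ)))) using 2 with m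
      rw [mul_assoc (a m), ← Complex.exp_add]
      congr 2
      push_cast
      ring)
  simp only [hterm] at hs
  rw [fourierCoefficient, hs.unique (hasSum_ite_eq k _)]
  field_simp

/-! ### Sine transform and the entries of `τ` matrices. -/

/-- The discrete sine transform matrix over the reals. -/
def sineMatrixReal (n : ℕ) : Matrix (Fin n) (Fin n) ℝ :=
  Matrix.of fun i j =>
    Real.sqrt (2 / ((n : ℝ) + 1)) * Real.sin ((((i : ℕ) : ℝ) + 1) * sineAngle n j)

lemma sineMatrix_eq_map (n : ℕ) : sineMatrix n = (sineMatrixReal n).map ((↑) : ℝ → ℂ) := rfl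

lemma sineMatrixReal_transpose (n : ℕ) : (sineMatrixReal n)ᵀ = sineMatrixReal n := by
  ext i j
  simp only [sineMatrixReal, Matrix.transpose_apply, Matrix.of_apply, sineAngle]
  congr 2
  ring

/-- Telescoping Dirichlet-kernel sum. -/
lemma two_mul_sin_mul_sum_cos (h : ℝ) (n : ℕ) :
    2 * Real.sin h * ∑ l ∈ Finset.range n, Real.cos (2 * h * ((l : ℝ) + 1)) =
      Real.sin ((2 * n + 1) * h) - Real.sin h := by
  induction n with
  | zero => simp
  | succ n ih =>
    rw [Finset.sum_range_succ, mul_add, ih, Nat.cast_succ,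
      show (2 * ((n : ℝ) + 1) + 1) * h = 2 * h * (n + 1) + h by ring,
      show (2 * (n : ℝ) + 1) * h = 2 * h * (n + 1) - h by ring, Real.sin_add, Real.sin_sub]
    ring

lemma cos_int_mul_sineAngle_sum (n : ℕ) (x : ℤ) :
    ∑ l : Fin n, Real.cos (x * sineAngle n l) =
      ((n : ℝ) + 1) * (if 2 * ((n : ℤ) + 1) ∣ x then 1 else 0) -
        (1 + Real.cos (x * Real.pi)) / 2 := by
  have hN : (n : ℝ) + 1 ≠ 0 := by positivity
  split_ifs with hd
  · obtain ⟨y, rfl⟩ := hd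
    have h1 : ∀ l : Fin n, Real.cos ((2 * ((n : ℤ) + 1) * y : ℤ) * sineAngle n l) = 1 := by
      intro l
      rw [Real.cos_eq_one_iff]
      refine ⟨y * ((l : ℕ) + 1), ?_⟩
      rw [sineAngle]
      push_cast
      field_simp
    have h2 : Real.cos ((2 * ((n : ℤ) + 1) * y : ℤ) * Real.pi) = 1 := by
      rw [Real.cos_eq_one_iff]
      exact ⟨((n : ℤ) + 1) * y, by push_cast; ring⟩
    simp only [h1, h2]
    simp
  · set h : ℝ := x * Real.pi / (2 * ((n : ℝ) + 1)) with hh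
    have hsin : Real.sin h ≠ 0 := by
      intro h0
      obtain ⟨y, hy⟩ := Real.sin_eq_zero_iff.1 h0
      refine hd ⟨y, ?_⟩
      rw [hh] at hy
      have hpi := Real.pi_ne_zero
      field_simp at hy
      have : ((x : ℤ) : ℝ) = ((2 * ((n : ℤ) + 1) * y : ℤ) : ℝ) := by push_cast; linarith
      exact_mod_cast this
    have key := two_mul_sin_mul_sum_cos h n
    rw [show (2 * (n : ℝ) + 1) * h = x * Real.pi - h by rw [hh]; field_simp; ring, Real.sin_sub,
      Real.sin_int_mul_pi, zero_mul, zero_sub] at key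
    have hs : ∑ l : Fin n, Real.cos (x * sineAngle n l) =
        ∑ l ∈ Finset.range n, Real.cos (2 * h * ((l : ℝ) + 1)) := by
      rw [Finset.sum_range]
      refine Finset.sum_congr rfl fun l _ => ?_
      rw [sineAngle, hh]
      congr 1
      field_simp
    rw [hs]
    apply mul_left_cancel₀ (mul_ne_zero two_ne_zero hsin)
    rw [key]
    ring

/-- Indicator of the multiples of `M`. -/
def dvdIndicator (M x : ℤ) : ℝ := if M ∣ x then 1 else 0

lemma dvdIndicator_neg (M x : ℤ) : dvdIndicator M (-x) = dvdIndicator M x := by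
  simp only [dvdIndicator, dvd_neg]

lemma dvdIndicator_nonneg (M x : ℤ) : 0 ≤ dvdIndicator M x := by
  rw [dvdIndicator]; split_ifs <;> norm_num

/-- Product-to-sum formulas reduce this to four cosine sums. The shift is `j + k + 2` because the
indices start at zero. -/
lemma sum_sine_cos_sine (n : ℕ) (j k : Fin n) (m : ℤ) :
    ∑ l, sineMatrixReal n j l * Real.cos (m * sineAngle n l) * sineMatrixReal n l k =
      (dvdIndicator (2 * ((n : ℤ) + 1)) (m + (j - k)) + dvdIndicator (2 * ((n : ℤ) + 1)) (m - (j - k))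
        - dvdIndicator (2 * ((n : ℤ) + 1)) (m + (j + k + 2))
        - dvdIndicator (2 * ((n : ℤ) + 1)) (m - (j + k + 2))) / 2 := by
  have hN : (0 : ℝ) < (n : ℝ) + 1 := by positivity
  have hterm : ∀ l, sineMatrixReal n j l * Real.cos (m * sineAngle n l) * sineMatrixReal n l k =
      1 / (2 * ((n : ℝ) + 1)) * (Real.cos ((m + (j - k) : ℤ) * sineAngle n l)
        + Real.cos ((m - (j - k) : ℤ) * sineAngle n l)
        - Real.cos ((m + (j + k + 2) : ℤ) * sineAngle n l)
        - Real.cos ((m - (j + k + 2) : ℤ) * sineAngle n l)) := by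
    intro l
    have hlk : sineMatrixReal n l k = sineMatrixReal n k l := by
      rw [← Matrix.transpose_apply (sineMatrixReal n), sineMatrixReal_transpose]
    have hsq := Real.mul_self_sqrt (show (0 : ℝ) ≤ 2 / ((n : ℝ) + 1) by positivity)
    rw [hlk]
    simp only [sineMatrixReal, Matrix.of_apply]
    set t := sineAngle n l
    have e1 : ((m + ((j : ℕ) - (k : ℕ)) : ℤ) : ℝ) * t =
      m * t + ((((j : ℕ) : ℝ) + 1) * t - (((k : ℕ) : ℝ) + 1) * t) := by push_cast; ring
    have e2 : ((m - ((j : ℕ) - (k : ℕ)) : ℤ) : ℝ) * t =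
      m * t - ((((j : ℕ) : ℝ) + 1) * t - (((k : ℕ) : ℝ) + 1) * t) := by push_cast; ring
    have e3 : ((m + ((j : ℕ) + (k : ℕ) + 2) : ℤ) : ℝ) * t =
      m * t + ((((j : ℕ) : ℝ) + 1) * t + (((k : ℕ) : ℝ) + 1) * t) := by push_cast; ring
    have e4 : ((m - ((j : ℕ) + (k : ℕ) + 2) : ℤ) : ℝ) * t =
      m * t - ((((j : ℕ) : ℝ) + 1) * t + (((k : ℕ) : ℝ) + 1) * t) := by push_cast; ring
    rw [e1, e2, e3, e4]
    generalize (((j : ℕ) : ℝ) + 1) * t = u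
    generalize (((k : ℕ) : ℝ) + 1) * t = v
    generalize (m : ℝ) * t = w
    rw [Real.cos_add w, Real.cos_sub w, Real.cos_add w, Real.cos_sub w, Real.cos_add u,
      Real.cos_sub u]
    have : (1 : ℝ) / (2 * ((n : ℝ) + 1)) = 2 / ((n : ℝ) + 1) / 4 := by field_simp; norm_num
    rw [this]
    linear_combination Real.sin u * Real.cos w * Real.sin v * hsq
  simp only [hterm]
  rw [← Finset.mul_sum]
  simp only [Finset.sum_sub_distrib, Finset.sum_add_distrib, cos_int_mul_sineAngle_sum]
  -- The four frequencies have the same parity, so the terms `(1 + cos xπ)/2` cancel.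
  have hp : ∀ y z : ℤ, Real.cos ((y : ℤ) * Real.pi) = Real.cos ((y - 2 * z : ℤ) * Real.pi) := by
    intro y z
    rw [← Real.cos_sub_int_mul_two_pi _ z]
    congr 1
    push_cast
    ring
  rw [hp (m + (j - k)) (j - k), hp (m + (j + k + 2)) (k + 1), hp (m - (j + k + 2)) (-(k + 1)),
    show m + ((j : ℤ) - k) - 2 * (j - k) = m - (j - k) by ring,
    show m - ((j : ℤ) + k + 2) - 2 * -(k + 1) = m - (j - k) by ring,
    show m + ((j : ℤ) + k + 2) - 2 * (k + 1) = m + (j - k) by ring,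
    hp (m + (j - k)) (j - k), show m + ((j : ℤ) - k) - 2 * (j - k) = m - (j - k) by ring]
  simp only [dvdIndicator]
  field_simp
  ring

lemma sineMatrixReal_mul_self (n : ℕ) : sineMatrixReal n * sineMatrixReal n = 1 := by
  ext j k
  have h := sum_sine_cos_sine n j k 0
  simp only [Int.cast_zero, zero_mul, Real.cos_zero, mul_one, zero_add, zero_sub,
    dvdIndicator_neg] at h
  rw [Matrix.mul_apply, h]
  have h1 : dvdIndicator (2 * ((n : ℤ) + 1)) (j + k + 2) = 0 := by
    rw [dvdIndicator, if_neg]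
    exact fun hd => absurd (Int.le_of_dvd (by omega) hd) (by omega)
  have h2 : dvdIndicator (2 * ((n : ℤ) + 1)) (j - k) = (1 : Matrix (Fin n) (Fin n) ℝ) j k := by
    rw [dvdIndicator, Matrix.one_apply]
    congr 1
    rw [eq_iff_iff]
    refine ⟨fun hd => ?_, fun h => by simp [h]⟩
    have := Int.eq_zero_of_abs_lt_dvd hd (by rw [abs_lt]; omega)
    exact Fin.ext (by omega)
  rw [h1, h2]
  ring

/-- The real `τ` matrix with eigenvalues `Q (θ_l)`. -/
def tauReal (n : ℕ) (Q : ℝ → ℝ) : Matrix (Fin n) (Fin n) ℝ :=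
  sineMatrixReal n * Matrix.diagonal (fun l => Q (sineAngle n l)) * sineMatrixReal n

/-- The periodization of `a` with period `M`. -/
def periodization (a : ℤ → ℝ) (M y : ℤ) : ℝ := ∑' p : ℤ, a (y + M * p)

lemma hasSum_periodization {a : ℤ → ℝ} (ha : Summable a) {M : ℤ} (hM : M ≠ 0) (y : ℤ) :
    HasSum (fun p : ℤ => a (y + M * p)) (periodization a M y) := by
  refine (ha.comp_injective (i := fun p : ℤ => y + M * p) fun p q h => ?_).hasSum
  simpa [hM] using h

lemma hasSum_mul_dvdIndicator {a : ℤ → ℝ} (ha : Summable a) {M : ℤ} (hM : M ≠ 0) (y : ℤ) :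
    HasSum (fun m : ℤ => a m * dvdIndicator M (m - y)) (periodization a M y) := by
  have hi : Function.Injective fun p : ℤ => y + M * p := fun p q h => by simpa [hM] using h
  rw [← hi.hasSum_iff fun m hm => ?_]
  · convert! hasSum_periodization ha hM y using 2 with p
    simp [dvdIndicator]
  · rw [dvdIndicator, if_neg, mul_zero]
    rintro ⟨p, hp⟩
    exact hm ⟨p, by simp only; omega⟩

lemma hasSum_mul_dvdIndicator_add {a : ℤ → ℝ} (ha : Summable a) (he : ∀ m, a (-m) = a m) {M : ℤ}
    (hM : M ≠ 0) (y : ℤ) :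
    HasSum (fun m : ℤ => a m * dvdIndicator M (m + y)) (periodization a M y) := by
  rw [← (Equiv.neg ℤ).hasSum_iff]
  convert! hasSum_mul_dvdIndicator ha hM y using 2 with m
  simp only [Function.comp_apply, Equiv.neg_apply]
  rw [he, ← dvdIndicator_neg, neg_add_rev, neg_neg, sub_eq_neg_add]

/-- Aliasing: sampling at the sine angles folds each frequency modulo `2(n+1)`, with odd reflection.
-/
lemma tauReal_apply {a : ℤ → ℝ} (ha : Summable a) (he : ∀ m, a (-m) = a m) {Q : ℝ → ℝ}
    (hQ : ∀ θ, HasSum (fun m : ℤ => a m * Real.cos (m * θ)) (Q θ)) {n : ℕ} (j k : Fin n) :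
    tauReal n Q j k = periodization a (2 * ((n : ℤ) + 1)) (j - k)
      - periodization a (2 * ((n : ℤ) + 1)) (j + k + 2) := by
  have hM : 2 * ((n : ℤ) + 1) ≠ 0 := by positivity
  have h1 : HasSum (fun m : ℤ => a m * ∑ l, sineMatrixReal n j l * Real.cos (m * sineAngle n l) *
      sineMatrixReal n l k) (tauReal n Q j k) := by
    rw [tauReal, Matrix.mul_apply]
    simp only [Matrix.mul_diagonal, Finset.mul_sum]
    refine hasSum_sum fun l _ => ?_
    convert! ((hQ (sineAngle n l)).mul_left (sineMatrixReal n j l)).mul_right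
      (sineMatrixReal n l k) using 2 with m
    ring
  refine h1.unique ?_
  -- Each periodization arises twice, from the indicators at `m + y` and `m - y`, which contribute
  -- equally since `a` is even.
  rw [show ∀ x y : ℝ, x - y = (x + x - y - y) / 2 from fun x y => by ring]
  convert! ((((hasSum_mul_dvdIndicator_add ha he hM ((j : ℤ) - k)).add
    (hasSum_mul_dvdIndicator ha hM ((j : ℤ) - k))).sub
    (hasSum_mul_dvdIndicator_add ha he hM ((j : ℤ) + k + 2))).sub
    (hasSum_mul_dvdIndicator ha hM ((j : ℤ) + k + 2))).div_const 2 using 2 with m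
  rw [sum_sine_cos_sine]
  ring

/-! ### One-variable comparison of `τ` and Toeplitz matrices. -/

/-- The real Toeplitz matrix with coefficients `a`. -/
def toeplitzReal (n : ℕ) (a : ℤ → ℝ) : Matrix (Fin n) (Fin n) ℝ :=
  Matrix.of fun j k => a ((j : ℤ) - k)

/-- A symmetric matrix with nonpositive off-diagonal entries and nonnegative row sums is positive
semidefinite. -/
lemma posSemidef_of_offDiag_nonpos {ι : Type*} [Fintype ι] {M : Matrix ι ι ℝ} (hs : M.IsSymm)
    (hoff : ∀ j k, j ≠ k → M j k ≤ 0) (hrow : ∀ j, 0 ≤ ∑ k, M j k) : M.PosSemidef := by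
  refine Matrix.PosSemidef.of_dotProduct_mulVec_nonneg
    (by rwa [Matrix.IsHermitian, Matrix.conjTranspose_eq_transpose_of_trivial]) fun x => ?_
  have h1 : ∑ j, ∑ k, M j k * x k ^ 2 = ∑ j, ∑ k, M j k * x j ^ 2 := by
    rw [Finset.sum_comm]
    exact Finset.sum_congr rfl fun j _ => Finset.sum_congr rfl fun k _ => by rw [hs.apply]
  -- A weighted graph Laplacian plus the diagonal of row sums.
  have h2 : star x ⬝ᵥ (M *ᵥ x) =
      ∑ j, (∑ k, M j k) * x j ^ 2 - (∑ j, ∑ k, M j k * (x j - x k) ^ 2) / 2 := by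
    have e : ∀ j k, M j k * (x j - x k) ^ 2 =
        M j k * x j ^ 2 + M j k * x k ^ 2 - 2 * (x j * (M j k * x k)) := fun j k => by ring
    simp only [e, Finset.sum_sub_distrib, Finset.sum_add_distrib, h1, Finset.sum_mul,
      ← Finset.mul_sum, dotProduct, Matrix.mulVec, star_trivial]
    ring
  rw [h2, sub_nonneg]
  have h3 : ∑ j, ∑ k, M j k * (x j - x k) ^ 2 ≤ 0 := by
    refine Finset.sum_nonpos fun j _ => Finset.sum_nonpos fun k _ => ?_
    obtain rfl | h := eq_or_ne j k
    · simp
    · exact mul_nonpos_of_nonpos_of_nonneg (hoff j k h) (sq_nonneg _)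
  have h4 : 0 ≤ ∑ j, (∑ k, M j k) * x j ^ 2 :=
    Finset.sum_nonneg fun j _ => mul_nonneg (hrow j) (sq_nonneg _)
  linarith

lemma toeplitzReal_isSymm {a : ℤ → ℝ} (he : ∀ m, a (-m) = a m) (n : ℕ) :
    (toeplitzReal n a).IsSymm := by
  ext j k
  simp only [toeplitzReal, Matrix.transpose_apply, Matrix.of_apply]
  rw [← he, neg_sub]

lemma tauReal_isSymm (n : ℕ) (Q : ℝ → ℝ) : (tauReal n Q).IsSymm := by
  rw [Matrix.IsSymm, tauReal, Matrix.transpose_mul, Matrix.transpose_mul, sineMatrixReal_transpose,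
    Matrix.diagonal_transpose, Matrix.mul_assoc]

/-- The polynomial `X ^ (n - 1 - j) (1 - X ^ (2 j + 2))`. -/
def reflectionPoly (n : ℕ) (j : Fin n) : Polynomial ℝ :=
  Polynomial.X ^ (n - 1 - (j : ℕ)) * (1 - Polynomial.X ^ (2 * (j : ℕ) + 2))

lemma reflectionPoly_eval_nonneg {n : ℕ} (j : Fin n) {x : ℝ} (hx : x ∈ Set.Ioo (0 : ℝ) 1) :
    0 ≤ (reflectionPoly n j).eval x := by
  simp only [reflectionPoly, Polynomial.eval_mul, Polynomial.eval_pow, Polynomial.eval_X,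
    Polynomial.eval_sub, Polynomial.eval_one]
  exact mul_nonneg (pow_nonneg hx.1.le _) (sub_nonneg.2 (pow_le_one₀ hx.1.le hx.2.le))

/-- The difference of the `τ` matrix and the Toeplitz matrix as a series of images. -/
lemma hasSum_tauReal_sub_toeplitzReal {a : ℤ → ℝ} (ha : Summable a) (he : ∀ m, a (-m) = a m)
    {Q : ℝ → ℝ} (hQ : ∀ θ, HasSum (fun m : ℤ => a m * Real.cos (m * θ)) (Q θ))
    {L : Polynomial ℝ →ₗ[ℝ] ℝ} (hL : ∀ k : ℕ, L (Polynomial.X ^ k) = -a ((k : ℤ) + 2))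
    {n : ℕ} (j k : Fin n) :
    HasSum (fun l : ℕ => L (Polynomial.X ^ (2 * l * (n + 1)) *
        (reflectionPoly n j * reflectionPoly n k)))
      ((tauReal n Q - toeplitzReal n a) j k - L (Polynomial.X ^ ((j : ℕ) + (k : ℕ)))) := by
  have hM : 2 * ((n : ℤ) + 1) ≠ 0 := by positivity
  -- Images `p` and `-p` are paired and `p = 0` is dropped. The dropped term is `a_{j-k} -
  -- a_{j+k+2}`, that is, the Toeplitz entry plus a Hankel moment. Index `l` below stands for `p =
  -- ±(l+1)`.
  have h := ((hasSum_periodization ha hM ((j : ℤ) - k)).sub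
    (hasSum_periodization ha hM ((j : ℤ) + k + 2))).nat_add_neg
  rw [← tauReal_apply ha he hQ, ← hasSum_nat_add_iff' 1] at h
  convert! h using 1
  · funext l
    obtain ⟨u, hu⟩ : ∃ u, n = (j : ℕ) + 1 + u := ⟨n - 1 - j, by omega⟩
    obtain ⟨v, hv⟩ : ∃ v, n = (k : ℕ) + 1 + v := ⟨n - 1 - k, by omega⟩
    have hp : Polynomial.X ^ (2 * l * (n + 1)) * (reflectionPoly n j * reflectionPoly n k) =
        (Polynomial.X ^ (2 * l * (n + 1) + u + v) : Polynomial ℝ)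
        - Polynomial.X ^ (2 * l * (n + 1) + u + v + (2 * (j : ℕ) + 2))
        - Polynomial.X ^ (2 * l * (n + 1) + u + v + (2 * (k : ℕ) + 2))
        + Polynomial.X ^ (2 * l * (n + 1) + u + v + (2 * (j : ℕ) + 2) + (2 * (k : ℕ) + 2)) := by
      rw [reflectionPoly, reflectionPoly, show n - 1 - (j : ℕ) = u by omega,
        show n - 1 - (k : ℕ) = v by omega]
      ring
    rw [hp, map_add, map_sub, map_sub, hL, hL, hL, hL, ← he (_ + 2)]
    rw [← he (((2 * l * (n + 1) + u + v + (2 * (k : ℕ) + 2) : ℕ) : ℤ) + 2)]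
    have hu' : (u : ℤ) = n - j - 1 := by omega
    have hv' : (v : ℤ) = n - k - 1 := by omega
    push_cast
    rw [hu', hv']
    have e1 : -(2 * (l : ℤ) * (n + 1) + (n - j - 1) + (n - k - 1) + 2) =
      j + k + 2 + 2 * (n + 1) * -(l + 1) := by ring
    have e2 : 2 * (l : ℤ) * (n + 1) + (n - j - 1) + (n - k - 1) + (2 * j + 2) + 2 =
      j - k + 2 * (n + 1) * (l + 1) := by ring
    have e3 : -(2 * (l : ℤ) * (n + 1) + (n - j - 1) + (n - k - 1) + (2 * k + 2) + 2) =
      j - k + 2 * (n + 1) * -(l + 1) := by ring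
    have e4 : 2 * (l : ℤ) * (n + 1) + (n - j - 1) + (n - k - 1) + (2 * j + 2) + (2 * k + 2) + 2 =
      j + k + 2 + 2 * (n + 1) * (l + 1) := by ring
    rw [e1, e2, e3, e4]
    ring
  · rw [hL]
    simp [toeplitzReal]
    ring

section Comparison

variable {a : ℤ → ℝ} (ha : Summable a) (he : ∀ m, a (-m) = a m)
  {Q : ℝ → ℝ} (hQ : ∀ θ, HasSum (fun m : ℤ => a m * Real.cos (m * θ)) (Q θ))
  {L : Polynomial ℝ →ₗ[ℝ] ℝ} (hL : ∀ k : ℕ, L (Polynomial.X ^ k) = -a ((k : ℤ) + 2))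
  (hLpos : ∀ p : Polynomial ℝ, (∀ x ∈ Set.Ioo (0 : ℝ) 1, 0 ≤ p.eval x) → 0 ≤ L p)

include ha he hQ hL hLpos

lemma tauReal_sub_toeplitzReal_nonneg {n : ℕ} (j k : Fin n) :
    0 ≤ (tauReal n Q - toeplitzReal n a) j k := by
  have h := (hasSum_tauReal_sub_toeplitzReal ha he hQ hL j k).nonneg fun l => hLpos _ fun x hx => ?_
  · have h' : 0 ≤ L (Polynomial.X ^ ((j : ℕ) + (k : ℕ))) := hLpos _ fun x hx => by
      simpa using pow_nonneg hx.1.le _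
    linarith
  · simp only [Polynomial.eval_mul, Polynomial.eval_pow, Polynomial.eval_X]
    exact mul_nonneg (pow_nonneg hx.1.le _)
      (mul_nonneg (reflectionPoly_eval_nonneg j hx) (reflectionPoly_eval_nonneg k hx))

/-- Each matrix in the image series, and the Hankel term, has quadratic form `L(r (∑ x_j p_j)²)`
with `r ≥ 0` on `(0,1)`. -/
lemma posSemidef_tauReal_sub_toeplitzReal (n : ℕ) :
    (tauReal n Q - toeplitzReal n a).PosSemidef := by
  refine Matrix.PosSemidef.of_dotProduct_mulVec_nonneg ?_ fun x => ?_
  · rw [Matrix.IsHermitian, Matrix.conjTranspose_eq_transpose_of_trivial]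
    exact (tauReal_isSymm n Q).sub (toeplitzReal_isSymm he n)
  · have hform : ∀ (r : Polynomial ℝ) (p : Fin n → Polynomial ℝ),
        ∑ j, ∑ k, x j * x k * L (r * (p j * p k)) = L (r * (∑ j, x j • p j) ^ 2) := by
      intro r p
      rw [sq, Finset.sum_mul_sum, Finset.mul_sum, map_sum]
      refine Finset.sum_congr rfl fun j _ => ?_
      rw [Finset.mul_sum, map_sum]
      refine Finset.sum_congr rfl fun k _ => ?_
      rw [smul_mul_smul_comm, mul_smul_comm, map_smul, smul_eq_mul]
    have hs : HasSum (fun l : ℕ => ∑ j, ∑ k, x j * x k * L (Polynomial.X ^ (2 * l * (n + 1)) *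
        (reflectionPoly n j * reflectionPoly n k)))
        (∑ j, ∑ k, x j * x k * ((tauReal n Q - toeplitzReal n a) j k -
          L (Polynomial.X ^ ((j : ℕ) + (k : ℕ))))) :=
      hasSum_sum fun j _ => hasSum_sum fun k _ =>
        (hasSum_tauReal_sub_toeplitzReal ha he hQ hL j k).mul_left _
    have h1 := hs.nonneg fun l => by
      rw [hform]
      refine hLpos _ fun y hy => ?_
      rw [Polynomial.eval_mul, Polynomial.eval_pow, Polynomial.eval_pow, Polynomial.eval_X]
      exact mul_nonneg (pow_nonneg hy.1.le _) (sq_nonneg _)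
    have h2 : 0 ≤ ∑ j : Fin n, ∑ k : Fin n,
        x j * x k * L (Polynomial.X ^ ((j : ℕ) + (k : ℕ))) := by
      have := hform 1 fun j : Fin n => Polynomial.X ^ (j : ℕ)
      simp only [one_mul, ← pow_add] at this
      rw [this]
      refine hLpos _ fun y hy => ?_
      rw [Polynomial.eval_pow]
      exact sq_nonneg _
    simp only [mul_sub, Finset.sum_sub_distrib, sub_nonneg] at h1
    refine h2.trans (h1.trans_eq ?_)
    simp only [dotProduct, Matrix.mulVec, star_trivial, Finset.mul_sum]
    exact Finset.sum_congr rfl fun j _ => Finset.sum_congr rfl fun k _ => by ring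

end Comparison

lemma dvdIndicator_add_of_dvd {n : ℕ} {y : ℤ} {k₀ : Fin n}
    (h : 2 * ((n : ℤ) + 1) ∣ y + (k₀ : ℤ)) (k : Fin n) :
    dvdIndicator (2 * ((n : ℤ) + 1)) (y + k) = if k = k₀ then 1 else 0 := by
  rw [dvdIndicator]
  congr 1
  rw [eq_iff_iff]
  refine ⟨fun hd => ?_, fun h' => h' ▸ h⟩
  have h1 := dvd_sub hd h
  have := Int.eq_zero_of_abs_lt_dvd h1 (by rw [abs_lt]; omega)
  exact Fin.ext (by omega)

/-- The values of `k` span fewer than `2(n+1)` consecutive integers, so at most one of them hits a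
given residue class. -/
lemma sum_dvdIndicator_add_le_one (n : ℕ) (y : ℤ) :
    ∑ k : Fin n, dvdIndicator (2 * ((n : ℤ) + 1)) (y + k) ≤ 1 := by
  by_cases h : ∃ k₀ : Fin n, 2 * ((n : ℤ) + 1) ∣ y + (k₀ : ℤ)
  · obtain ⟨k₀, hk₀⟩ := h
    simp [dvdIndicator_add_of_dvd hk₀]
  · push Not at h
    rw [Finset.sum_eq_zero fun k _ => by rw [dvdIndicator, if_neg (h k)]]
    exact zero_le_one

lemma rowSum_two_toeplitzReal_sub_tauReal_nonneg {a : ℤ → ℝ} (ha0 : HasSum a 0)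
    (he : ∀ m, a (-m) = a m) (hneg : ∀ m, m ≠ 0 → a m ≤ 0) {Q : ℝ → ℝ}
    (hQ : ∀ θ, HasSum (fun m : ℤ => a m * Real.cos (m * θ)) (Q θ)) {n : ℕ} (j : Fin n) :
    0 ≤ ∑ k, (2 * toeplitzReal n a j k - tauReal n Q j k) := by
  have ha := ha0.summable
  set M : ℤ := 2 * ((n : ℤ) + 1) with hMdef
  have hM : M ≠ 0 := by positivity
  have h1 : HasSum (fun m : ℤ => ∑ k : Fin n, (2 * (if m = (j : ℤ) - k then a m else 0) -
      (a m * dvdIndicator M (m - (j - k)) - a m * dvdIndicator M (m - (j + k + 2)))) - a m)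
      -- Subtracting `∑ a_m = 0` changes nothing in total but makes the series nonnegative term by
      -- term.
      (∑ k, (2 * toeplitzReal n a j k - tauReal n Q j k) - 0) := by
    refine HasSum.sub (hasSum_sum fun k _ => ?_) ha0
    rw [tauReal_apply ha he hQ]
    refine HasSum.sub (HasSum.mul_left 2 ?_) ((hasSum_mul_dvdIndicator ha hM _).sub
      (hasSum_mul_dvdIndicator ha hM _))
    convert! hasSum_ite_eq ((j : ℤ) - k) (a ((j : ℤ) - k)) using 2 with m
    split_ifs with h
    · rw [h]
    · rfl
  rw [← sub_zero (∑ k, _)]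
  refine h1.nonneg fun m => ?_
  have hB : ∀ k : Fin n, m - ((j : ℤ) - k) = (m - j) + k := fun k => by ring
  have hC : ∀ k : Fin n, dvdIndicator M (m - ((j : ℤ) + k + 2)) =
      dvdIndicator M ((j + 2 - m) + k) := fun k => by
    rw [← dvdIndicator_neg]; congr 1; ring
  simp only [hB, hC]
  by_cases hm : ∃ k₀ : Fin n, m = (j : ℤ) - k₀
  · obtain ⟨k₀, hk₀⟩ := hm
    have h2 : ∀ k : Fin n, dvdIndicator M ((m - j) + k) = if k = k₀ then 1 else 0 := fun k =>
      dvdIndicator_add_of_dvd (by rw [hk₀]; ring_nf; exact dvd_zero _) k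
    -- Here `j + 2 - m + k = k₀ + k + 2` lies strictly between `0` and `2(n+1)`. The total factor of
    -- `a_m` is thus `2 - 1 - 1 = 0`.
    have h3 : ∀ k : Fin n, dvdIndicator M ((j + 2 - m) + k) = 0 := fun k => by
      rw [dvdIndicator, if_neg]
      exact fun hd => absurd (Int.le_of_dvd (by omega) hd) (by omega)
    have h4 : ∀ k : Fin n, (if m = (j : ℤ) - k then a m else 0) = if k = k₀ then a m else 0 := by
      intro k
      congr 1
      rw [eq_iff_iff, Fin.ext_iff]
      omega
    simp only [h2, h3, h4, mul_zero, sub_zero, Finset.sum_sub_distrib, ← Finset.mul_sum,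
      Finset.sum_ite_eq', Finset.mem_univ, if_true]
    linarith
  · push Not at hm
    have hm0 : m ≠ 0 := fun h => hm j (by rw [h, sub_self])
    have h4 : ∀ k : Fin n, (if m = (j : ℤ) - k then a m else 0) = 0 := fun k => if_neg (hm k)
    simp only [h4, mul_zero, zero_sub, neg_sub, Finset.sum_sub_distrib, ← Finset.mul_sum]
    have h5 := sum_dvdIndicator_add_le_one n (j + 2 - m)
    have h6 : 0 ≤ ∑ k : Fin n, dvdIndicator M ((m - j) + k) :=
      Finset.sum_nonneg fun k _ => dvdIndicator_nonneg _ _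
    rw [← hMdef] at h5
    -- The factor of `a_m ≤ 0` is a sum that is at most `1`, minus a nonnegative sum, minus `1`.
    nlinarith [hneg m hm0]

lemma posSemidef_two_toeplitzReal_sub_tauReal {a : ℤ → ℝ} (ha0 : HasSum a 0)
    (he : ∀ m, a (-m) = a m) (hneg : ∀ m, m ≠ 0 → a m ≤ 0)
    {Q : ℝ → ℝ} (hQ : ∀ θ, HasSum (fun m : ℤ => a m * Real.cos (m * θ)) (Q θ))
    {L : Polynomial ℝ →ₗ[ℝ] ℝ} (hL : ∀ k : ℕ, L (Polynomial.X ^ k) = -a ((k : ℤ) + 2))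
    (hLpos : ∀ p : Polynomial ℝ, (∀ x ∈ Set.Ioo (0 : ℝ) 1, 0 ≤ p.eval x) → 0 ≤ L p) (n : ℕ) :
    ((2 : ℝ) • toeplitzReal n a - tauReal n Q).PosSemidef := by
  refine posSemidef_of_offDiag_nonpos
    (((toeplitzReal_isSymm he n).smul 2).sub (tauReal_isSymm n Q)) (fun j k hjk => ?_)
    (fun j => rowSum_two_toeplitzReal_sub_tauReal_nonneg ha0 he hneg hQ j)
  have h1 := tauReal_sub_toeplitzReal_nonneg ha0.summable he hQ hL hLpos j k
  have h2 : toeplitzReal n a j k ≤ 0 :=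
    hneg _ fun h => hjk (Fin.ext (by omega))
  simp only [Matrix.sub_apply, Matrix.smul_apply, smul_eq_mul] at h1 ⊢
  linarith

lemma posDef_tauReal {Q : ℝ → ℝ} (hQ : ∀ θ ∈ Set.Ioo 0 Real.pi, 0 < Q θ) (n : ℕ) :
    (tauReal n Q).PosDef := by
  have hd : (Matrix.diagonal fun l : Fin n => Q (sineAngle n l)).PosDef := by
    refine Matrix.PosDef.diagonal fun l => hQ _ ⟨?_, ?_⟩
    · have := Real.pi_pos
      rw [sineAngle]
      positivity
    · rw [sineAngle, div_lt_iff₀ (by positivity), mul_comm]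
      refine mul_lt_mul_of_pos_left ?_ Real.pi_pos
      exact_mod_cast Nat.succ_lt_succ l.2
  have h := hd.conjTranspose_mul_mul_same (B := sineMatrixReal n)
    (Matrix.mulVec_injective_of_isUnit (IsUnit.of_mul_eq_one _ (sineMatrixReal_mul_self n)))
  rwa [Matrix.conjTranspose_eq_transpose_of_trivial, sineMatrixReal_transpose] at h

/-! ### Passage to complex matrices and the spectral bound. -/

open scoped MatrixOrder in
lemma posSemidef_map_ofReal {ι : Type*} [Fintype ι] [DecidableEq ι] {M : Matrix ι ι ℝ}
    (hM : M.PosSemidef) : (M.map ((↑) : ℝ → ℂ)).PosSemidef := by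
  obtain ⟨B, rfl⟩ := CStarAlgebra.nonneg_iff_eq_star_mul_self.mp hM.nonneg
  have h : (star B * B).map ((↑) : ℝ → ℂ) =
      (B.map ((↑) : ℝ → ℂ))ᴴ * B.map ((↑) : ℝ → ℂ) := by
    ext i j
    simp [Matrix.mul_apply, Matrix.star_eq_conjTranspose]
  rw [h]
  exact Matrix.posSemidef_conjTranspose_mul_self _

open scoped MatrixOrder in
lemma posDef_map_ofReal {ι : Type*} [Fintype ι] [DecidableEq ι] {M : Matrix ι ι ℝ}
    (hM : M.PosDef) : (M.map ((↑) : ℝ → ℂ)).PosDef := by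
  rw [(posSemidef_map_ofReal hM.posSemidef).posDef_iff_isUnit]
  exact hM.isUnit.map (RingHom.mapMatrix Complex.ofRealHom)

/-- The spectrum of `P⁻¹ A` when `P / 2 ≤ A ≤ P` in the Loewner order. -/
lemma spectrum_inv_mul_subset {ι : Type*} [Fintype ι] [DecidableEq ι] {P A : Matrix ι ι ℂ}
    (hP : P.PosDef) (h1 : ((2 : ℂ) • A - P).PosSemidef) (h2 : (P - A).PosSemidef) :
    spectrum ℂ (P⁻¹ * A) ⊆ (fun x : ℝ => (x : ℂ)) '' Set.Icc (1 / 2) 1 := by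
  intro z hz
  rw [spectrum.mem_iff, Matrix.isUnit_iff_isUnit_det, isUnit_iff_ne_zero, not_not,
    ← Matrix.exists_mulVec_eq_zero_iff] at hz
  obtain ⟨v, hv, hzv⟩ := hz
  have hPu : IsUnit P.det := (Matrix.isUnit_iff_isUnit_det _).1 hP.isUnit
  rw [Matrix.sub_mulVec, sub_eq_zero, Algebra.algebraMap_eq_smul_one, Matrix.smul_mulVec,
    Matrix.one_mulVec] at hzv
  have hA : A *ᵥ v = z • (P *ᵥ v) := by
    rw [← Matrix.mulVec_smul, hzv, Matrix.mulVec_mulVec, Matrix.mul_nonsing_inv_cancel_left _ _ hPu]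
  have hp := hP.dotProduct_mulVec_pos hv
  have h1' := h1.dotProduct_mulVec_nonneg v
  have h2' := h2.dotProduct_mulVec_nonneg v
  rw [Matrix.sub_mulVec, Matrix.smul_mulVec, hA, dotProduct_sub, dotProduct_smul,
    dotProduct_smul] at h1'
  rw [Matrix.sub_mulVec, hA, dotProduct_sub, dotProduct_smul] at h2'
  obtain ⟨x, hx⟩ : ∃ x : ℝ, star v ⬝ᵥ (P *ᵥ v) = x :=
    ⟨_, Complex.ext rfl (by simpa using (Complex.pos_iff.1 hp).2.symm)⟩
  rw [hx] at hp h1' h2'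
  rw [Complex.zero_lt_real] at hp
  rw [Complex.nonneg_iff] at h1' h2'
  simp at h1' h2'
  -- Nonnegativity in `ℂ` includes reality, so the Loewner bound itself forces the eigenvalue to be
  -- real.
  have him : z.im = 0 := by
    rcases h2'.2 with h | h
    · exact h
    · linarith
  refine ⟨z.re, ⟨?_, ?_⟩, Complex.ext (by simp) (by simp [him])⟩
  · by_contra! h
    nlinarith
  · by_contra! h
    nlinarith

/-- The complex Toeplitz matrix of `qSymbol`. -/
def symbolToeplitz (γ : ℝ) (n : ℕ) : Matrix (Fin n) (Fin n) ℂ :=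
  (toeplitzReal n (symbolCoeff γ)).map ((↑) : ℝ → ℂ)

/-- The complex `τ` matrix of `qSymbol`. -/
def symbolTau (γ : ℝ) (n : ℕ) : Matrix (Fin n) (Fin n) ℂ :=
  (tauReal n fun θ => (qSymbol γ θ).re).map ((↑) : ℝ → ℂ)

lemma symbolToeplitz_isSymm (γ : ℝ) (n : ℕ) : (symbolToeplitz γ n).IsSymm :=
  (toeplitzReal_isSymm (symbolCoeff_neg γ) n).map _

lemma symbolTau_isSymm (γ : ℝ) (n : ℕ) : (symbolTau γ n).IsSymm :=
  (tauReal_isSymm n _).map _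

lemma posDef_symbolTau {γ : ℝ} (hγ : γ ∈ Set.Ioo (1 : ℝ) 2) (n : ℕ) : (symbolTau γ n).PosDef :=
  posDef_map_ofReal (posDef_tauReal (fun _ hθ => qSymbol_re_pos hγ hθ) n)

lemma posSemidef_symbolTau_sub {γ : ℝ} (hγ : γ ∈ Set.Ioo (1 : ℝ) 2) (n : ℕ) :
    (symbolTau γ n - symbolToeplitz γ n).PosSemidef := by
  obtain ⟨L, hLpos, hL⟩ := exists_moment_functional hγ
  have h := posSemidef_map_ofReal (posSemidef_tauReal_sub_toeplitzReal (summable_symbolCoeff hγ)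
    (symbolCoeff_neg γ) (hasSum_symbolCoeff_cos hγ) hL hLpos n)
  rwa [Matrix.map_sub _ Complex.ofReal_sub] at h

lemma posSemidef_two_symbolToeplitz_sub {γ : ℝ} (hγ : γ ∈ Set.Ioo (1 : ℝ) 2) (n : ℕ) :
    ((2 : ℂ) • symbolToeplitz γ n - symbolTau γ n).PosSemidef := by
  obtain ⟨L, hLpos, hL⟩ := exists_moment_functional hγ
  have h := posSemidef_map_ofReal (posSemidef_two_toeplitzReal_sub_tauReal
    (hasSum_symbolCoeff_zero hγ) (symbolCoeff_neg γ)
    (fun m hm => (symbolCoeff_neg_of_ne_zero hγ hm).le) (hasSum_symbolCoeff_cos hγ) hL hLpos n)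
  convert! h using 1
  ext j k
  simp [symbolToeplitz, symbolTau]

/-- `T` is the half-sum of `τ`, which is positive definite, and `2T - τ`. -/
lemma posDef_symbolToeplitz {γ : ℝ} (hγ : γ ∈ Set.Ioo (1 : ℝ) 2) (n : ℕ) :
    (symbolToeplitz γ n).PosDef := by
  have h := ((posDef_symbolTau hγ n).posSemidef_add (posSemidef_two_symbolToeplitz_sub hγ n)).smul
    (show (0 : ℝ) < 1 / 2 by norm_num)
  convert! h using 1
  ext j k
  simp

/-! ### Identification of the matrices of the scheme and of the preconditioner. -/

lemma toeplitz_const_add_mul_qSymbol {γ : ℝ} (hγ : γ ∈ Set.Ioo (1 : ℝ) 2) (n : ℕ) (b c : ℂ) :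
    toeplitz n (fun θ => b + c * qSymbol γ θ) = b • 1 + c • symbolToeplitz γ n := by
  have key : ∀ m : ℤ, fourierCoefficient (fun θ => b + c * qSymbol γ θ) m =
      (if m = 0 then b else 0) + c * symbolCoeff γ m := by
    intro m
    refine fourierCoefficient_eq (a := fun m : ℤ => (if m = 0 then b else 0) + c * symbolCoeff γ m)
      ?_ (fun θ => ?_) m
    · refine Summable.norm (Summable.add (hasSum_ite_eq 0 b).summable ?_)
      exact (Complex.summable_ofReal.2 (summable_symbolCoeff hγ)).mul_left c
    · convert! (hasSum_ite_eq (0 : ℤ) b).add ((hasSum_symbolCoeff hγ θ).mul_left c) using 2 with m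
      rw [add_mul, mul_assoc c]
      congr 1
      split_ifs with h
      · simp [h]
      · rw [zero_mul]
  ext j k
  have hjk : ((j : ℕ) : ℤ) - ((k : ℕ) : ℤ) = 0 ↔ j = k := by rw [Fin.ext_iff]; omega
  simp [toeplitz, key, symbolToeplitz, toeplitzReal, Matrix.one_apply, hjk]

lemma toeplitz_mul_qSymbol {γ : ℝ} (hγ : γ ∈ Set.Ioo (1 : ℝ) 2) (n : ℕ) (c : ℂ) :
    toeplitz n (fun θ => c * qSymbol γ θ) = c • symbolToeplitz γ n := by
  simpa using toeplitz_const_add_mul_qSymbol hγ n 0 c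

lemma sineMatrix_mul_self (n : ℕ) : sineMatrix n * sineMatrix n = 1 := by
  have h := congrArg (RingHom.mapMatrix Complex.ofRealHom) (sineMatrixReal_mul_self n)
  rwa [map_mul, map_one] at h

lemma symbolTau_eq (γ : ℝ) (n : ℕ) : symbolTau γ n =
    sineMatrix n * Matrix.diagonal (fun l => qSymbol γ (sineAngle n l)) * sineMatrix n := by
  have hd : (Matrix.diagonal fun l : Fin n => qSymbol γ (sineAngle n l)) =
      (Matrix.diagonal fun l : Fin n => (qSymbol γ (sineAngle n l)).re).map ((↑) : ℝ → ℂ) := by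
    rw [Matrix.diagonal_map Complex.ofReal_zero]
    congr 1
    exact funext fun l => qSymbol_eq_re γ _
  rw [hd, symbolTau, tauReal, sineMatrix_eq_map]
  exact (Matrix.map_mul (f := Complex.ofRealHom)).trans
    (congrArg (· * _) (Matrix.map_mul (f := Complex.ofRealHom)))

/-- The sine matrix is an involution, so conjugation fixes the identity factors and the diagonal
splits into its one-variable parts. -/
lemma tauMatrix_eq (α β : ℝ) (n₁ n₂ : ℕ) (b c c' : ℂ) :
    tauMatrix n₁ n₂ (fun θ₁ θ₂ => b + c * qSymbol α θ₁ + c' * qSymbol β θ₂) =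
      b • 1 + c • ((1 : Matrix (Fin n₂) (Fin n₂) ℂ) ⊗ₖ symbolTau α n₁) +
        c' • (symbolTau β n₂ ⊗ₖ (1 : Matrix (Fin n₁) (Fin n₁) ℂ)) := by
  have hd : Matrix.diagonal (fun p : Fin n₂ × Fin n₁ => b + c * qSymbol α (sineAngle n₁ p.2) +
      c' * qSymbol β (sineAngle n₂ p.1)) =
      b • ((1 : Matrix (Fin n₂) (Fin n₂) ℂ) ⊗ₖ (1 : Matrix (Fin n₁) (Fin n₁) ℂ)) +
      c • ((1 : Matrix (Fin n₂) (Fin n₂) ℂ) ⊗ₖ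
        Matrix.diagonal fun l => qSymbol α (sineAngle n₁ l)) +
      c' • ((Matrix.diagonal fun l => qSymbol β (sineAngle n₂ l)) ⊗ₖ
        (1 : Matrix (Fin n₁) (Fin n₁) ℂ)) := by
    rw [← Matrix.diagonal_one, ← Matrix.diagonal_one, Matrix.diagonal_kronecker_diagonal,
      Matrix.diagonal_kronecker_diagonal, Matrix.diagonal_kronecker_diagonal,
      ← Matrix.diagonal_smul, ← Matrix.diagonal_smul, ← Matrix.diagonal_smul,
      Matrix.diagonal_add, Matrix.diagonal_add]
    congr 1
    funext p
    simp
  rw [tauMatrix, hd]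
  simp only [mul_add, add_mul, Matrix.mul_smul, Matrix.smul_mul, ← Matrix.mul_kronecker_mul,
    mul_one, sineMatrix_mul_self, symbolTau_eq, Matrix.one_kronecker_one]

lemma secondOrderMatrix_apply (γ : ℝ) {n : ℕ} (k j : Fin n) :
    secondOrderMatrix γ n k j = shiftCoeff γ ((k : ℤ) - j) := by
  rw [secondOrderMatrix, Matrix.of_apply, shiftCoeff]
  by_cases h : (j : ℕ) ≤ (k : ℕ) + 1
  · rw [if_pos h, if_pos (by omega)]
    congr 2
    omega
  · rw [if_neg h, if_neg (by omega)]

lemma secondOrderMatrix_add_transpose (γ : ℝ) (n : ℕ) :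
    secondOrderMatrix γ n + (secondOrderMatrix γ n)ᵀ = toeplitzReal n (symbolCoeff γ) := by
  ext k j
  simp [secondOrderMatrix_apply, toeplitzReal, symbolCoeff]

lemma coefficientMatrix_const (α β L₁ R₁ L₂ R₂ ht : ℝ) (n₁ n₂ : ℕ) (d e t : ℝ) :
    coefficientMatrix α β L₁ R₁ L₂ R₂ ht n₁ n₂
      (fun _ _ _ => d) (fun _ _ _ => d) (fun _ _ _ => e) (fun _ _ _ => e) t =
      (1 / stepRatio α L₁ R₁ ht n₁) • (1 : Matrix (Fin n₂ × Fin n₁) (Fin n₂ × Fin n₁) ℝ) +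
      d • ((1 : Matrix (Fin n₂) (Fin n₂) ℝ) ⊗ₖ toeplitzReal n₁ (symbolCoeff α)) +
      (stepRatio β L₂ R₂ ht n₂ / stepRatio α L₁ R₁ ht n₁ * e) •
        (toeplitzReal n₂ (symbolCoeff β) ⊗ₖ (1 : Matrix (Fin n₁) (Fin n₁) ℝ)) := by
  have hc : ∀ c : ℝ, coeffDiag L₁ R₁ L₂ R₂ n₁ n₂ (fun _ _ _ => c) t = c • 1 := fun c => by
    rw [coeffDiag, Matrix.smul_one_eq_diagonal]
  rw [coefficientMatrix, hc, hc, ← mul_add, ← mul_add, ← Matrix.kronecker_add,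
    ← Matrix.add_kronecker, secondOrderMatrix_add_transpose, secondOrderMatrix_add_transpose,
    Matrix.smul_mul, Matrix.smul_mul, one_mul, one_mul, smul_smul]

lemma stepRatio_pos (γ : ℝ) {L R ht : ℝ} (h : L < R) (hht : 0 < ht) (n : ℕ) :
    0 < stepRatio γ L R ht n := by
  have h1 : 0 < meshSize L R n := div_pos (sub_pos.2 h) (by positivity)
  have h2 := Real.rpow_pos_of_pos h1 γ
  rw [stepRatio]
  positivity

/-! ### Assembly in two dimensions. -/

/-- The two-dimensional matrix `b I + c (I ⊗ X) + c' (Y ⊗ I)`. -/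
def kroneckerCombination {n₁ n₂ : ℕ} (b c c' : ℂ) (X : Matrix (Fin n₁) (Fin n₁) ℂ)
    (Y : Matrix (Fin n₂) (Fin n₂) ℂ) : Matrix (Fin n₂ × Fin n₁) (Fin n₂ × Fin n₁) ℂ :=
  b • 1 + c • ((1 : Matrix (Fin n₂) (Fin n₂) ℂ) ⊗ₖ X) +
    c' • (Y ⊗ₖ (1 : Matrix (Fin n₁) (Fin n₁) ℂ))

lemma posSemidef_kroneckerCombination {n₁ n₂ : ℕ} {b c c' : ℂ} (hb : 0 ≤ b) (hc : 0 ≤ c)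
    (hc' : 0 ≤ c') {X : Matrix (Fin n₁) (Fin n₁) ℂ} {Y : Matrix (Fin n₂) (Fin n₂) ℂ}
    (hX : X.PosSemidef) (hY : Y.PosSemidef) : (kroneckerCombination b c c' X Y).PosSemidef :=
  ((Matrix.PosSemidef.one.smul hb).add ((Matrix.PosSemidef.one.kronecker hX).smul hc)).add
    ((hY.kronecker Matrix.PosSemidef.one).smul hc')

lemma isSPD_kroneckerCombination {n₁ n₂ : ℕ} {b c c' : ℂ} (hb : 0 < b) (hc : 0 ≤ c)
    (hc' : 0 ≤ c') {X : Matrix (Fin n₁) (Fin n₁) ℂ} {Y : Matrix (Fin n₂) (Fin n₂) ℂ}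
    (hX : X.PosSemidef) (hY : Y.PosSemidef) (hXs : X.IsSymm) (hYs : Y.IsSymm) :
    IsSPD (kroneckerCombination b c c' X Y) := by
  refine ⟨((Matrix.isSymm_one.smul b).add (Matrix.IsSymm.smul ?_ c)).add (Matrix.IsSymm.smul ?_ c'),
    ((Matrix.PosDef.one.smul hb).add_posSemidef
      ((Matrix.PosSemidef.one.kronecker hX).smul hc)).add_posSemidef
      ((hY.kronecker Matrix.PosSemidef.one).smul hc')⟩
  · rw [Matrix.IsSymm, ← Matrix.kroneckerMap_transpose, hXs.eq, Matrix.transpose_one]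
  · rw [Matrix.IsSymm, ← Matrix.kroneckerMap_transpose, hYs.eq, Matrix.transpose_one]

lemma kroneckerCombination_sub {n₁ n₂ : ℕ} (b b₁ c c' : ℂ) (X X₁ : Matrix (Fin n₁) (Fin n₁) ℂ)
    (Y Y₁ : Matrix (Fin n₂) (Fin n₂) ℂ) :
    kroneckerCombination b c c' X Y - kroneckerCombination b₁ c c' X₁ Y₁ =
      kroneckerCombination (b - b₁) c c' (X - X₁) (Y - Y₁) := by
  ext p q
  simp only [kroneckerCombination, Matrix.sub_apply, Matrix.add_apply, Matrix.smul_apply,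
    Matrix.kroneckerMap_apply, smul_eq_mul]
  ring

lemma smul_kroneckerCombination {n₁ n₂ : ℕ} (z b c c' : ℂ) (X : Matrix (Fin n₁) (Fin n₁) ℂ)
    (Y : Matrix (Fin n₂) (Fin n₂) ℂ) :
    z • kroneckerCombination b c c' X Y = kroneckerCombination (z * b) c c' (z • X) (z • Y) := by
  rw [kroneckerCombination, kroneckerCombination, Matrix.kronecker_smul, Matrix.smul_kronecker]
  module

end FracDiff

end

theorem mainTheorem2 (α β : ℝ) (hα : α ∈ Set.Ioo (1 : ℝ) 2) (hβ : β ∈ Set.Ioo (1 : ℝ) 2)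
    (L₁ R₁ L₂ R₂ : ℝ) (h₁ : L₁ < R₁) (h₂ : L₂ < R₂)
    (d e : ℝ) (hd : 0 < d) (he : 0 < e) :
    ∃ c C : ℝ, 0 < c ∧ 0 < C ∧
      ∀ (n₁ n₂ : ℕ) (ht : ℝ), 0 < ht →
        ∀ (r s : ℝ), r = FracDiff.stepRatio α L₁ R₁ ht n₁ → s = FracDiff.stepRatio β L₂ R₂ ht n₂ →
        ∀ (Ahat A : Matrix (Fin n₁) (Fin n₁) ℂ) (B : Matrix (Fin n₂) (Fin n₂) ℂ)
          (AN P : Matrix (Fin n₂ × Fin n₁) (Fin n₂ × Fin n₁) ℂ),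
        Ahat = FracDiff.toeplitz n₁ (fun θ => (d : ℂ) * FracDiff.qSymbol α θ) →
        A = FracDiff.toeplitz n₁ (fun θ => 1 / (r : ℂ) + (d : ℂ) * FracDiff.qSymbol α θ) →
        B = FracDiff.toeplitz n₂ (fun θ => (e : ℂ) * ((s : ℂ) / (r : ℂ)) * FracDiff.qSymbol β θ) →
        AN = (1 : Matrix (Fin n₂) (Fin n₂) ℂ) ⊗ₖ A + B ⊗ₖ (1 : Matrix (Fin n₁) (Fin n₁) ℂ) →
        P = FracDiff.tauMatrix n₁ n₂ (fun θ₁ θ₂ =>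
              1 / (r : ℂ) + (d : ℂ) * FracDiff.qSymbol α θ₁
                + (s : ℂ) / (r : ℂ) * (e : ℂ) * FracDiff.qSymbol β θ₂) →
        -- the coefficient matrix of the scheme is `AN`
        (∀ t : ℝ, (FracDiff.coefficientMatrix α β L₁ R₁ L₂ R₂ ht n₁ n₂
            (fun _ _ _ => d) (fun _ _ _ => d) (fun _ _ _ => e) (fun _ _ _ => e) t).map
              (fun x : ℝ => (x : ℂ)) = AN) ∧
        AN = (1 / (r : ℂ)) • (1 : Matrix (Fin n₂ × Fin n₁) (Fin n₂ × Fin n₁) ℂ)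
              + (1 : Matrix (Fin n₂) (Fin n₂) ℂ) ⊗ₖ Ahat
              + B ⊗ₖ (1 : Matrix (Fin n₁) (Fin n₁) ℂ) ∧
        A = (1 / (r : ℂ)) • (1 : Matrix (Fin n₁) (Fin n₁) ℂ) + Ahat ∧
        Ahat = FracDiff.toeplitz n₁
              (fun θ => (d : ℂ) * (FracDiff.wSymbol α θ + FracDiff.wSymbol α (-θ))) ∧
        B = FracDiff.toeplitz n₂ (fun θ => (e : ℂ) * ((s : ℂ) / (r : ℂ)) *
              (FracDiff.wSymbol β θ + FracDiff.wSymbol β (-θ))) ∧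
        FracDiff.IsSPD A ∧ FracDiff.IsSPD B ∧ FracDiff.IsSPD AN ∧ FracDiff.IsSPD P ∧
        -- the spectrum of the preconditioned matrix is real and lies in `[c, C]`
        spectrum ℂ (P⁻¹ * AN) ⊆ (fun x : ℝ => (x : ℂ)) '' Set.Icc c C := by
  -- The constants of `τ/2 ≤ T ≤ τ`, which depend on neither the orders, the sizes nor the time
  -- step.
  refine ⟨1 / 2, 1, by norm_num, one_pos, ?_⟩
  rintro n₁ n₂ ht hht r s hr hs Ahat A B AN P rfl rfl rfl rfl rfl
  have hr0 : 0 < r := hr ▸ FracDiff.stepRatio_pos α h₁ hht n₁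
  have hs0 : 0 < s := hs ▸ FracDiff.stepRatio_pos β h₂ hht n₂
  have hb : (0 : ℂ) < 1 / (r : ℂ) := by exact_mod_cast one_div_pos.2 hr0
  have hd' : (0 : ℂ) < (d : ℂ) := by exact_mod_cast hd
  have he' : (0 : ℂ) < (s : ℂ) / (r : ℂ) * (e : ℂ) := by
    exact_mod_cast mul_pos (div_pos hs0 hr0) he
  have hTα := FracDiff.posDef_symbolToeplitz hα n₁
  have hTβ := FracDiff.posDef_symbolToeplitz hβ n₂
  have hTαs := FracDiff.symbolToeplitz_isSymm α n₁
  have hTβs := FracDiff.symbolToeplitz_isSymm β n₂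
  have hτα := FracDiff.posDef_symbolTau hα n₁
  have hτβ := FracDiff.posDef_symbolTau hβ n₂
  simp only [← FracDiff.qSymbol_eq hα, ← FracDiff.qSymbol_eq hβ, FracDiff.tauMatrix_eq,
    FracDiff.toeplitz_mul_qSymbol hα, FracDiff.toeplitz_const_add_mul_qSymbol hα,
    FracDiff.toeplitz_mul_qSymbol hβ, mul_comm (e : ℂ)]
  have hAN : (1 : Matrix (Fin n₂) (Fin n₂) ℂ) ⊗ₖ
      ((1 / (r : ℂ)) • (1 : Matrix (Fin n₁) (Fin n₁) ℂ) + (d : ℂ) • FracDiff.symbolToeplitz α n₁) +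
      (((s : ℂ) / (r : ℂ) * (e : ℂ)) • FracDiff.symbolToeplitz β n₂) ⊗ₖ
        (1 : Matrix (Fin n₁) (Fin n₁) ℂ) =
      FracDiff.kroneckerCombination (1 / (r : ℂ)) d ((s : ℂ) / (r : ℂ) * (e : ℂ))
        (FracDiff.symbolToeplitz α n₁) (FracDiff.symbolToeplitz β n₂) := by
    rw [FracDiff.kroneckerCombination, Matrix.kronecker_add, Matrix.kronecker_smul,
      Matrix.kronecker_smul, Matrix.smul_kronecker, Matrix.one_kronecker_one]
  have hP := FracDiff.isSPD_kroneckerCombination hb hd'.le he'.le hτα.posSemidef hτβ.posSemidef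
    (FracDiff.symbolTau_isSymm α n₁) (FracDiff.symbolTau_isSymm β n₂)
  refine ⟨fun t => ?_, ?_, trivial, trivial, trivial, ⟨(Matrix.isSymm_one.smul _).add (hTαs.smul _),
    (Matrix.PosDef.one.smul hb).add (hTα.smul hd')⟩, ⟨hTβs.smul _, hTβ.smul he'⟩, ?_, hP, ?_⟩
  · rw [hAN, FracDiff.coefficientMatrix_const, ← hr, ← hs]
    ext p q
    have hone : ∀ {ι : Type} [DecidableEq ι] (i j : ι),
        (((1 : Matrix ι ι ℝ) i j : ℝ) : ℂ) = (1 : Matrix ι ι ℂ) i j := fun i j => by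
      rw [Matrix.one_apply, Matrix.one_apply]
      split_ifs <;> simp
    simp only [FracDiff.kroneckerCombination, FracDiff.symbolToeplitz, Matrix.map_apply,
      Matrix.add_apply, Matrix.smul_apply, Matrix.kroneckerMap_apply, smul_eq_mul,
      Complex.ofReal_add, Complex.ofReal_mul, Complex.ofReal_div, Complex.ofReal_one, hone]
  · rw [Matrix.kronecker_add, Matrix.kronecker_smul, Matrix.one_kronecker_one]
  · rw [hAN]
    exact FracDiff.isSPD_kroneckerCombination hb hd'.le he'.le hTα.posSemidef hTβ.posSemidef
      hTαs hTβs
  · rw [hAN]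
    refine FracDiff.spectrum_inv_mul_subset hP.2 ?_ ?_
    · change (_ - FracDiff.kroneckerCombination _ _ _ _ _).PosSemidef
      rw [FracDiff.smul_kroneckerCombination, FracDiff.kroneckerCombination_sub]
      refine FracDiff.posSemidef_kroneckerCombination ?_ hd'.le he'.le
        (FracDiff.posSemidef_two_symbolToeplitz_sub hα n₁)
        (FracDiff.posSemidef_two_symbolToeplitz_sub hβ n₂)
      -- The identity part of `2 A_N - P` is `2/r - 1/r = 1/r`; in `P - A_N` below it cancels.
      rw [two_mul, add_sub_cancel_right]
      exact hb.le
    · change (FracDiff.kroneckerCombination _ _ _ _ _ - _).PosSemidef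
      rw [FracDiff.kroneckerCombination_sub, sub_self]
      exact FracDiff.posSemidef_kroneckerCombination le_rfl hd'.le he'.le
        (FracDiff.posSemidef_symbolTau_sub hα n₁) (FracDiff.posSemidef_symbolTau_sub hβ n₂)
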